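/- **Definitions.** Let $\mathbb C$ be a category and $\mathcal E$ a class of morphisms of $\mathbb C$. Write $\mathsf{Ext}(\mathbb C)=\mathsf{Ext}_{\mathcal E}(\mathbb C)$ for the full subcategory of the arrow category $\mathsf{Arr}(\mathbb C)$ on the morphisms in $\mathcal E$, and $(\mathbb C\downarrow B)$ for the full subcategory of the slice category $\mathbb C/B$ on the morphisms $A\to B$ in $\mathcal E$. Let $\mathcal E^1$ be the class of those morphisms of $\mathsf{Ext}(\mathbb C)$, i.e. commutative squares $b\circ f'=f\circ a$ with $a\colon A'\to A$ and $b\colon B'\to B$ in $\mathcal E$, for which $f\colon A\to B$, $f'\colon A'\to B'$ and the induced morphism $(a,f')\colon A'\to A\times_B B'$ all lie in $\mathcal E$. A *Galois structure* $\Gamma=(\mathbb C,\mathbb X,I,H,\eta,\mathcal E)$ consists of a category $\mathbb C$, a full replete reflective subcategory $\mathbb X$ with inclusion $H\colon\mathbb X\to\mathbb C$, left adjoint $I$ of $H$ and unit $\eta_A\colon A\to HI(A)$, and a class $\mathcal E$ of morphisms of $\mathbb C$ such that - (E1) $\mathcal E$ contains all isomorphisms; - (E2) the pullback of a morphism in $\mathcal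 E$ along any morphism of $\mathbb C$ exists and lies in $\mathcal E$; - (E3) $\mathcal E$ is closed under composition; - (G) $HI(\mathcal E)\subseteq\mathcal E$. A *monadic extension* is a morphism $p\colon E\to B$ in $\mathcal E$ such that the pullback functor $p^*\colon(\mathbb C\downarrow B)\to(\mathbb C\downarrow E)$ is monadic. A *trivial covering* is a morphism $f\colon A\to B$ in $\mathcal E$ whose naturality square $HI(f)\circ\eta_A=\eta_B\circ f$ is a pullback. A morphism $f\colon A\to B$ in $\mathcal E$ is *split by* a monadic extension $p\colon E\to B$ if the pullback $p^*(f)$ is a trivial covering of $E$. A *covering* is a morphism in $\mathcal E$ that is split by some monadic extension, and a *normal extension* is a monadic extension that is split by itself. Consider the following conditions on $\Gamma$: - (E4) if $g\circ f\in\mathcal E$ then $g\in\mathcal E$; - (E5) every split epimorphism of $\mathsf{Ext}(\mathbb C)$ lies in $\mathcal E^1$; - (M) every morphism in $\mathcal E$ is a monadic extension; - (B) $\mathbb X$ is a strongly $\mathcal E$-Birkhoff subcategory: for every $f\colon A\to B$ in $\mathcal E$, the naturality square $(\eta_A,\eta_B)\colon f\to HI(f)$ lies in $\mathcal E^1$.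 **Theorem.** For every Galois structure $\Gamma=(\mathbb C,\mathbb X,I,H,\eta,\mathcal E)$ satisfying (E4), (E5), (M) and (B), there exists a Galois structure $\Gamma_1=(\mathbb C_1,\mathbb X_1,I_1,H_1,\eta^1,\mathcal E^1)$, again satisfying (E4), (E5), (M) and (B), such that $\mathbb C_1=\mathsf{Ext}(\mathbb C)$, $\mathbb X_1$ is its full subcategory consisting exactly of the coverings with respect to $\Gamma$, and $\mathcal E^1$ is the class defined above. Hence there is a chain of Galois structures $\Gamma_n=(\mathbb C_n,\mathbb X_n,I_n,H_n,\eta^n,\mathcal E^n)$, $n\ge 0$, with $\Gamma_0=\Gamma$, all satisfying (E4), (E5), (M) and (B), such that for every $n\ge1$ the category $\mathbb C_n$ is the full subcategory $\mathsf{Ext}_{\mathcal E^{n-1}}(\mathbb C_{n-1})$ of $\mathsf{Arr}(\mathbb C_{n-1})$ on the morphisms in $\mathcal E^{n-1}$, $\mathbb X_n$ is its full subcategory consisting exactly of the coverings with respect to $\Gamma_{n-1}$, and $\mathcal E^n=(\mathcal E^{n-1})^1$. Moreover, for every $n\ge0$, every morphism in $\mathcal E^n$ is a monadic extension with respect to $\Gamma_n$,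 and every covering with respect to $\Gamma_n$ is a normal extension. -/

import Mathlib

open CategoryTheory CategoryTheory.Limits

universe v u

namespace HigherGalois

section Extensions

variable {C : Type u} [Category.{v} C]

/-- The category `Ext(C)`: the full subcategory of the arrow category of `C` on the arrows
that belong to the class `E`. -/
abbrev Ext (E : MorphismProperty C) : Type (max u v) :=
  ObjectProperty.FullSubcategory (fun f : Arrow C => E f.hom)

/-- A morphism of `E`, as an object of `Ext(C)`. -/
abbrev Ext.mk {E : MorphismProperty C} {A B : C} (f : A ⟶ B) (hf : E f) : Ext E :=
  ⟨Arrow.mk f, hf⟩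

/-- A commutative square between morphisms of `E`, as a morphism of `Ext(C)`. -/
abbrev Ext.homMk {E : MorphismProperty C} {A B A' B' : C} {f : A ⟶ B} {g : A' ⟶ B'}
    (hf : E f) (hg : E g) (t : A ⟶ A') (s : B ⟶ B') (w : t ≫ g = f ≫ s) :
    Ext.mk f hf ⟶ Ext.mk g hg :=
  ObjectProperty.homMk (Arrow.homMk t s w)

/-- The class `E¹` of morphisms of `Ext(C)`. A morphism `φ : a ⟶ b`, that is, a commutative square
with sides `a : A' ⟶ A` and `b : B' ⟶ B` in `E`, top `f' : A' ⟶ B'` and bottom `f : A ⟶ B`,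
belongs to `E¹` when `f` and `f'` belong to `E` and the induced morphism from `A'` to the
pullback `P` of `f` and `b` belongs to `E`. -/
def extClass (E : MorphismProperty C) : MorphismProperty (Ext E) := fun a b φ =>
  E φ.hom.left ∧ E φ.hom.right ∧
    ∃ (P : C) (p₁ : P ⟶ a.obj.right) (p₂ : P ⟶ b.obj.left) (k : a.obj.left ⟶ P),
      IsPullback p₁ p₂ φ.hom.right b.obj.hom ∧
      k ≫ p₁ = a.obj.hom ∧ k ≫ p₂ = φ.hom.left ∧ E k

/-- (E4): if a composite "`f` followed by `g`" is in `E`, then so is `g`. -/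
def CondE4 (E : MorphismProperty C) : Prop :=
  ∀ ⦃A B D : C⦄ (f : A ⟶ B) (g : B ⟶ D), E (f ≫ g) → E g

/-- (E5): every split epimorphism of `Ext(C)` belongs to `E¹`. -/
def CondE5 (E : MorphismProperty C) : Prop :=
  ∀ ⦃a b : Ext E⦄ (φ : a ⟶ b), IsSplitEpi φ → extClass E φ

end Extensions

/-- A Galois structure on the category `C` with respect to the class `E` of morphisms of `C`. -/
structure GaloisStructure {C : Type u} [Category.{v} C] (E : MorphismProperty C) where
  /-- the objects of the full subcategory `X` -/
  X : ObjectProperty C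
  /-- `X` is replete -/
  replete : X.IsClosedUnderIsomorphisms
  /-- the reflector -/
  I : C ⥤ X.FullSubcategory
  /-- the reflector is left adjoint to the inclusion functor `H = X.ι` -/
  adj : I ⊣ X.ι
  /-- (E1): `E` contains all isomorphisms -/
  e1 : ∀ ⦃A B : C⦄ (f : A ⟶ B), IsIso f → E f
  /-- (E2), existence: a morphism of `E` has a pullback along every morphism of `C` -/
  e2_exists : E.HasPullbacks
  /-- (E2), stability: the pullback of a morphism of `E` is in `E` -/
  e2_stable : E.IsStableUnderBaseChange
  /-- (E3): `E` is closed under composition -/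
  e3 : ∀ ⦃A B D : C⦄ (f : A ⟶ B) (g : B ⟶ D), E f → E g → E (f ≫ g)
  /-- (G): the functor `HI` preserves the class `E` -/
  g : ∀ ⦃A B : C⦄ (f : A ⟶ B), E f → E ((I ⋙ X.ι).map f)

namespace GaloisStructure

variable {C : Type u} [Category.{v} C] {E : MorphismProperty C} (Γ : GaloisStructure E)

/-- The composite `HI : C ⥤ C`. -/
abbrev HI : C ⥤ C := Γ.I ⋙ Γ.X.ι

/-- The reflection unit `η_A : A ⟶ HI(A)`. -/
abbrev η (A : C) : A ⟶ Γ.HI.obj A := Γ.adj.unit.app A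

/-- For `p : T ⟶ B`, the pullback functor `p^* : (C ↓ B) ⥤ (C ↓ T)`. Here `(C ↓ B)`, written
`E.Over ⊤ B`, is the full subcategory of the slice category over `B` on the morphisms in `E`. -/
noncomputable def pullbackFunctor {T B : C} (p : T ⟶ B) : E.Over ⊤ B ⥤ E.Over ⊤ T :=
  haveI := Γ.e2_exists
  haveI := Γ.e2_stable
  MorphismProperty.Over.pullback E ⊤ p

/-- A monadic extension (effective `E`-descent morphism): a morphism `p` in `E` for which the
pullback functor `p^*` is monadic. -/
def IsMonadicExtension {T B : C} (p : T ⟶ B) : Prop :=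
  E p ∧ Nonempty (MonadicRightAdjoint (Γ.pullbackFunctor p))

/-- A trivial covering: a morphism in `E` whose naturality square for `η` is a pullback. -/
def IsTrivialCovering {A B : C} (f : A ⟶ B) : Prop :=
  E f ∧ IsPullback (Γ.η A) f (Γ.HI.map f) (Γ.η B)

/-- The pullback of `f` along `p` is a trivial covering. -/
def IsSplitBy {A T B : C} (f : A ⟶ B) (p : T ⟶ B) : Prop :=
  ∃ (P : C) (q : P ⟶ A) (h : P ⟶ T), IsPullback q h f p ∧ Γ.IsTrivialCovering h

/-- A covering: a morphism in `E` that is split by some monadic extension. -/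
def IsCovering {A B : C} (f : A ⟶ B) : Prop :=
  E f ∧ ∃ (T : C) (p : T ⟶ B), Γ.IsMonadicExtension p ∧ Γ.IsSplitBy f p

/-- A normal extension: a monadic extension that is split by itself. -/
def IsNormalExtension {T B : C} (p : T ⟶ B) : Prop :=
  Γ.IsMonadicExtension p ∧ Γ.IsSplitBy p p

/-- The coverings, as a class of objects of `Ext(C)`. -/
def coverings : ObjectProperty (Ext E) := fun f => Γ.IsCovering f.obj.hom

/-- The naturality square of `η` at a morphism `f` of `E`, as a morphism of `Ext(C)`
from `f` to `HI(f)`. -/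
def unitSquare {A B : C} (f : A ⟶ B) (hf : E f) :
    Ext.mk f hf ⟶ Ext.mk (Γ.HI.map f) (Γ.g f hf) :=
  Ext.homMk hf (Γ.g f hf) (Γ.η A) (Γ.η B) (Γ.adj.unit.naturality f).symm

/-- (M): every morphism in `E` is a monadic extension. -/
def CondM : Prop := ∀ ⦃T B : C⦄ (p : T ⟶ B), E p → Γ.IsMonadicExtension p

/-- (B): the subcategory `X` is strongly `E`-Birkhoff. -/
def CondB : Prop := ∀ ⦃A B : C⦄ (f : A ⟶ B) (hf : E f), extClass E (Γ.unitSquare f hf)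

/-- The conditions (E4), (E5), (M) and (B). The conditions (E1), (E2), (E3) and (G) are part of
the notion of a Galois structure. -/
structure Conditions : Prop where
  e4 : CondE4 E
  e5 : CondE5 E
  m : Γ.CondM
  b : Γ.CondB

end GaloisStructure

/-- A category together with a class of morphisms. -/
structure CatWithClass where
  /-- the objects -/
  carrier : Type u
  /-- the category structure -/
  [cat : Category.{v} carrier]
  /-- the class of morphisms -/
  E : MorphismProperty carrier

attribute [instance] CatWithClass.cat

/-- The iterated extension categories with their classes of morphisms:
`iterExt E n` is the pair `(C_{n+1}, E^{n+1})`, where `C_1 = Ext(C)`, `E^1 = extClass E`,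
`C_{n+1} = Ext(C_n)` is the full subcategory of the arrow category of `C_n` on the morphisms
in `E^n`, and `E^{n+1} = (E^n)^1 = extClass E^n`. -/
def iterExt {C : Type u} [Category.{v} C] (E : MorphismProperty C) :
    ℕ → CatWithClass.{v, max u v}
  | 0 => { carrier := Ext E, E := extClass E }
  | n + 1 => { carrier := Ext (iterExt E n).E, E := extClass (iterExt E n).E }

end HigherGalois

/-! Three things must pass from `Γ` to `Ext E`: the axioms on the class, monadicity of pullback
functors, and a strongly Birkhoff reflection.

Axioms. Pulling back a square of `extClass E` is done separately on domains and codomains, so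
stability and closure under composition reduce to pasting. (E4) and (E5) for squares both come from
(E5) for `E`: pulling `φ ≫ ψ` back along `ψ` produces a split epimorphism, and the limit of a cube
can be computed in two orders.

Monadicity. By Beck's theorem, (M) amounts to two elementary statements about pullback squares,
`ReflectsIsosAlong` and `CreatesSplitCoequalizersAlong`. Each holds for a square of `extClass E`
once it holds for its domain and codomain components.

Reflection. Over `B`, the extensions split by `f : A ⟶ B` are those that `f^*` sends to trivial
coverings of `A`. Since `f^*` sends `f` to a kernel pair projection, which has an evident reflection
into trivial coverings, it suffices to descend that reflection along the monadic functor `f^*`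
(`exists_reflection_of_monadic`). This needs the monad to preserve morphisms inverted by the
reflector, which follows from the central lemma `isPullback_reflection_map`: the reflector preserves
pullbacks of extensions along split epimorphisms. There (B) and (E5) put the comparison morphism of
a cube in `E`; it is a monomorphism, and (M) makes monomorphisms in `E` invertible.

The same preservation makes triviality of split epimorphisms descend, so kernel pair projections of
a covering are trivial and every covering is normal. Condition (B) for the new reflection is
`coveringReflection_comparison_mem`: after base change, the comparison to be tested becomes that of
a split cube, and (E4) descends the conclusion. -/

namespace HigherGalois

/-! ### The axioms (E1)-(E5) for squares. -/

section ExtensionClass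

variable {C : Type u} [Category.{v} C] {E : MorphismProperty C}

/-- The conditions (E1)-(E5) on a class of morphisms. -/
structure ExtensionClass (E : MorphismProperty C) : Prop where
  e1 : ∀ ⦃A B : C⦄ (f : A ⟶ B), IsIso f → E f
  hasPullbacks : E.HasPullbacks
  stable : E.IsStableUnderBaseChange
  comp : ∀ ⦃A B D : C⦄ {f : A ⟶ B} {g : B ⟶ D}, E f → E g → E (f ≫ g)
  e4 : CondE4 E
  e5 : CondE5 E

namespace ExtensionClass

variable (h : ExtensionClass E)
include h

lemma exists_pullback {A B D : C} {f : A ⟶ B} (hf : E f) (g : D ⟶ B) :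
    ∃ (P : C) (fst : P ⟶ A) (snd : P ⟶ D), IsPullback fst snd f g :=
  haveI := h.hasPullbacks
  haveI := MorphismProperty.hasPullback g hf
  ⟨_, _, _, IsPullback.of_hasPullback f g⟩

lemma snd {P A B D : C} {f : A ⟶ B} {g : D ⟶ B} {fst : P ⟶ A} {snd : P ⟶ D}
    (sq : IsPullback fst snd f g) (hf : E f) : E snd :=
  haveI := h.stable
  E.of_isPullback sq hf

lemma fst {P A B D : C} {f : A ⟶ B} {g : D ⟶ B} {fst : P ⟶ A} {snd : P ⟶ D}
    (sq : IsPullback fst snd f g) (hg : E g) : E fst :=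
  h.snd sq.flip hg

lemma of_comp {A B D : C} {f : A ⟶ B} {g : B ⟶ D} (hfg : E (f ≫ g)) : E g :=
  h.e4 f g hfg

lemma id (A : C) : E (𝟙 A) := h.e1 _ inferInstance

lemma of_section {A B : C} {f : A ⟶ B} {s : B ⟶ A} (hs : s ≫ f = 𝟙 B) : E f :=
  h.of_comp (f := s) (by rw [hs]; exact h.id B)

lemma of_eq_comp {A B D : C} {f : A ⟶ B} {g : B ⟶ D} {k : A ⟶ D} (w : f ≫ g = k)
    (hf : E f) (hg : E g) : E k :=
  w ▸ h.comp hf hg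

lemma of_comp_eq {A B D : C} {f : A ⟶ B} {g : B ⟶ D} {k : A ⟶ D} (w : f ≫ g = k)
    (hk : E k) : E g :=
  h.of_comp (f := f) (by rwa [w])

end ExtensionClass

@[ext]
lemma Ext.hom_ext {a b : Ext E} {φ ψ : a ⟶ b} (hl : φ.hom.left = ψ.hom.left)
    (hr : φ.hom.right = ψ.hom.right) : φ = ψ := by
  apply InducedCategory.hom_ext
  ext
  · exact hl
  · exact hr

lemma Ext.w {a b : Ext E} (φ : a ⟶ b) :
    φ.hom.left ≫ b.obj.hom = a.obj.hom ≫ φ.hom.right :=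
  Arrow.w φ.hom

lemma Ext.isIso {a b : Ext E} (φ : a ⟶ b) (hl : IsIso φ.hom.left) (hr : IsIso φ.hom.right) :
    IsIso φ := by
  have : IsIso φ.hom := Arrow.isIso_of_isIso_left_of_isIso_right φ.hom
  exact (ObjectProperty.isIso_hom_iff φ).1 inferInstance

lemma Ext.isIso_left {a b : Ext E} (φ : a ⟶ b) (hφ : IsIso φ) : IsIso φ.hom.left :=
  haveI : IsIso φ.hom := inferInstance
  inferInstance

lemma Ext.isIso_right {a b : Ext E} (φ : a ⟶ b) (hφ : IsIso φ) : IsIso φ.hom.right :=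
  haveI : IsIso φ.hom := inferInstance
  inferInstance

/-- A square of `Ext E` that is a pullback on domains and on codomains is a pullback. -/
lemma Ext.isPullback {p a b c : Ext E} {s : p ⟶ a} {t : p ⟶ c} {φ : a ⟶ b} {ψ : c ⟶ b}
    (hl : IsPullback s.hom.left t.hom.left φ.hom.left ψ.hom.left)
    (hr : IsPullback s.hom.right t.hom.right φ.hom.right ψ.hom.right) :
    IsPullback s t φ ψ := by
  refine IsPullback.mk' ?_ ?_ ?_
  · ext
    · exact hl.w
    · exact hr.w
  · intro T x y h₁ h₂
    ext
    · exact hl.hom_ext (congrArg (fun z => z.hom.left) h₁) (congrArg (fun z => z.hom.left) h₂)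
    · exact hr.hom_ext (congrArg (fun z => z.hom.right) h₁) (congrArg (fun z => z.hom.right) h₂)
  · intro T x y w
    obtain ⟨l, hl₁, hl₂⟩ := hl.exists_lift x.hom.left y.hom.left
      (congrArg (fun z => z.hom.left) w)
    obtain ⟨r, hr₁, hr₂⟩ := hr.exists_lift x.hom.right y.hom.right
      (congrArg (fun z => z.hom.right) w)
    refine ⟨ObjectProperty.homMk (Arrow.homMk l r ?_), ?_, ?_⟩
    · apply hr.hom_ext
      · rw [Category.assoc, Category.assoc, hr₁, ← Ext.w s, reassoc_of% hl₁, Ext.w x]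
      · rw [Category.assoc, Category.assoc, hr₂, ← Ext.w t, reassoc_of% hl₂, Ext.w y]
    · ext
      · exact hl₁
      · exact hr₁
    · ext
      · exact hl₂
      · exact hr₂

/-- Two pullbacks of the same cospan differ by an isomorphism, so the one provided by the definition
can be exchanged for any other. -/
lemma extClass.comparison (hE : ExtensionClass E) {a b : Ext E} {φ : a ⟶ b} (hφ : extClass E φ)
    {P : C} {p₁ : P ⟶ a.obj.right} {p₂ : P ⟶ b.obj.left} {k : a.obj.left ⟶ P}
    (sq : IsPullback p₁ p₂ φ.hom.right b.obj.hom) (h₁ : k ≫ p₁ = a.obj.hom)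
    (h₂ : k ≫ p₂ = φ.hom.left) : E k := by
  obtain ⟨-, -, P', p₁', p₂', k', sq', h₁', h₂', hk'⟩ := hφ
  refine hE.of_eq_comp (f := k') (g := (sq'.isoIsPullback _ _ sq).hom) ?_ hk'
    (hE.e1 _ inferInstance)
  apply sq.hom_ext <;> simp [h₁, h₂, h₁', h₂']

lemma extClass.exists_comparison (hE : ExtensionClass E) {a b : Ext E} {φ : a ⟶ b}
    (hl : E φ.hom.left) (hr : E φ.hom.right)
    (H : ∀ ⦃P : C⦄ ⦃p₁ : P ⟶ a.obj.right⦄ ⦃p₂ : P ⟶ b.obj.left⦄ ⦃k : a.obj.left ⟶ P⦄,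
      IsPullback p₁ p₂ φ.hom.right b.obj.hom → k ≫ p₁ = a.obj.hom → k ≫ p₂ = φ.hom.left → E k) :
    extClass E φ := by
  obtain ⟨P, p₁, p₂, sq⟩ := hE.exists_pullback hr b.obj.hom
  obtain ⟨k, h₁, h₂⟩ := sq.exists_lift a.obj.hom φ.hom.left (Ext.w φ).symm
  exact ⟨hl, hr, P, p₁, p₂, k, sq, h₁, h₂, H sq h₁ h₂⟩

lemma extClass_of_isIso (hE : ExtensionClass E) {a b : Ext E} (φ : a ⟶ b) (hφ : IsIso φ) :
    extClass E φ := by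
  have hl := Ext.isIso_left φ hφ
  have hr := Ext.isIso_right φ hφ
  refine ⟨hE.e1 _ hl, hE.e1 _ hr, b.obj.left, b.obj.hom ≫ inv φ.hom.right, 𝟙 _, φ.hom.left, ?_, ?_,
    ?_, hE.e1 _ hl⟩
  · exact (IsPullback.of_vert_isIso ⟨by simp⟩)
  · rw [← Category.assoc, Ext.w φ]; simp
  · simp

/-- Pullbacks in `Ext E` along morphisms of `extClass E` are computed on domains and codomains. -/
lemma extClass.exists_levelwise_pullback (hE : ExtensionClass E) {a b c : Ext E} {φ : a ⟶ b}
    (hφ : extClass E φ) (ψ : c ⟶ b) :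
    ∃ (p : Ext E) (s : p ⟶ a) (t : p ⟶ c),
      IsPullback s.hom.left t.hom.left φ.hom.left ψ.hom.left ∧
      IsPullback s.hom.right t.hom.right φ.hom.right ψ.hom.right ∧ extClass E t := by
  obtain ⟨hl, hr, Q, q₁, q₂, k₀, sqQ, hk₁, hk₂, hk₀⟩ := hφ
  obtain ⟨P', s', t', sq'⟩ := hE.exists_pullback hl ψ.hom.left
  obtain ⟨P, s, t, sq⟩ := hE.exists_pullback hr ψ.hom.right
  obtain ⟨R, r₁, r₂, sqR⟩ := hE.exists_pullback (hE.snd sq hr) c.obj.hom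
  obtain ⟨m, hm₁, hm₂⟩ := sqQ.exists_lift (r₁ ≫ s) (r₂ ≫ ψ.hom.left) (by
    rw [Category.assoc, Category.assoc, sq.w, Ext.w ψ, reassoc_of% sqR.w])
  obtain ⟨k, hk₃, hk₄⟩ : ∃ k : P' ⟶ R, k ≫ r₁ ≫ s = s' ≫ a.obj.hom ∧ k ≫ r₂ = t' := by
    obtain ⟨l, hl₁, hl₂⟩ := sq.exists_lift (s' ≫ a.obj.hom) (t' ≫ c.obj.hom) (by
      rw [Category.assoc, Category.assoc, ← Ext.w φ, ← Ext.w ψ, reassoc_of% sq'.w])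
    obtain ⟨k, h₁, h₂⟩ := sqR.exists_lift l t' hl₂
    exact ⟨k, by rw [reassoc_of% h₁, hl₁], h₂⟩
  -- Pasting exhibits the new comparison `k` as a base change of the old one `k₀`. Hence `k` is in
  -- `E`, and `k ≫ r₁` is an object of `Ext E`.
  have sqm : IsPullback m r₂ q₂ ψ.hom.left := by
    refine (IsPullback.of_bot (v₂₁ := q₁) (v₂₂ := b.obj.hom) (h₃₁ := φ.hom.right) ?_ hm₂.symm
      sqQ.flip).flip
    rw [hm₁, Ext.w ψ]
    exact sqR.flip.paste_vert sq.flip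
  have sqk : IsPullback s' k k₀ m := by
    refine IsPullback.of_bot (v₂₁ := r₂) (v₂₂ := q₂) (h₃₁ := ψ.hom.left) ?_ ?_ sqm
    · rw [hk₂, hk₄]; exact sq'
    · apply sqQ.hom_ext
      · rw [Category.assoc, Category.assoc, hk₁, hm₁, hk₃]
      · rw [Category.assoc, Category.assoc, hk₂, hm₂, reassoc_of% hk₄, sq'.w]
  have hk : E k := hE.snd sqk hk₀
  have hr₁ : E r₁ := hE.fst sqR c.property
  refine ⟨Ext.mk (k ≫ r₁) (hE.comp hk hr₁),
    ObjectProperty.homMk (Arrow.homMk s' s (by simp [hk₃])),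
    ObjectProperty.homMk (Arrow.homMk t' t (by simp [sqR.w, reassoc_of% hk₄])), sq', sq,
    hE.snd sq' hl, hE.snd sq hr, R, r₁, r₂, k, sqR, rfl, hk₄, hk⟩

/-- The comparison of the composite is the comparison of `φ` followed by a base change of the
comparison of `ψ`. -/
lemma extClass.comp (hE : ExtensionClass E) {a b c : Ext E} {φ : a ⟶ b} {ψ : b ⟶ c}
    (hφ : extClass E φ) (hψ : extClass E ψ) : extClass E (φ ≫ ψ) := by
  obtain ⟨hψl, hψr, P, p₁, p₂, k, sq, h₁, h₂, hk⟩ := hψ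
  have hp₁ : E p₁ := hE.fst sq c.property
  obtain ⟨Q, q₁, q₂, sqQ⟩ := hE.exists_pullback hp₁ φ.hom.right
  obtain ⟨R, r₁, r₂, sqR⟩ := hE.exists_pullback hφ.2.1 b.obj.hom
  obtain ⟨l, hl₁, hl₂⟩ := sqR.exists_lift a.obj.hom φ.hom.left (Ext.w φ).symm
  have hl : E l := hφ.comparison hE sqR hl₁ hl₂
  obtain ⟨m, hm₁, hm₂⟩ := sqQ.exists_lift (r₂ ≫ k) r₁ (by rw [Category.assoc, h₁, sqR.w])
  have sqm : IsPullback r₂ m k q₁ := by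
    refine IsPullback.of_bot (v₂₁ := q₂) (v₂₂ := p₁) (h₃₁ := φ.hom.right) ?_ hm₁.symm sqQ
    rw [h₁, hm₂]; exact sqR.flip
  refine ⟨hE.comp hφ.1 hψl, hE.comp hφ.2.1 hψr, Q, q₂, q₁ ≫ p₂, l ≫ m, ?_, ?_, ?_,
    hE.comp hl (hE.snd sqm hk)⟩
  · exact (sqQ.flip.paste_vert sq)
  · rw [Category.assoc, hm₂, hl₁]
  · rw [Category.assoc, reassoc_of% hm₁, h₂, reassoc_of% hl₂]; rfl

/-- A pullback in `Ext E` along a morphism of `extClass E` is a pullback on domains and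
codomains. -/
lemma extClass.isPullback_levelwise (hE : ExtensionClass E) {p a b c : Ext E} {s : p ⟶ a}
    {t : p ⟶ c} {φ : a ⟶ b} {ψ : c ⟶ b} (sq : IsPullback s t φ ψ) (hφ : extClass E φ) :
    IsPullback s.hom.left t.hom.left φ.hom.left ψ.hom.left ∧
      IsPullback s.hom.right t.hom.right φ.hom.right ψ.hom.right ∧ extClass E t := by
  obtain ⟨p', s', t', hl, hr, ht⟩ := hφ.exists_levelwise_pullback hE ψ
  let e := sq.isoIsPullback _ _ (Ext.isPullback hl hr)
  have he₁ : e.hom ≫ s' = s := IsPullback.isoIsPullback_hom_fst ..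
  have he₂ : e.hom ≫ t' = t := IsPullback.isoIsPullback_hom_snd ..
  have hel := Ext.isIso_left e.hom inferInstance
  have her := Ext.isIso_right e.hom inferInstance
  have w₁ : e.hom.hom.left ≫ s'.hom.left = s.hom.left := congrArg (fun z => z.hom.left) he₁
  have w₂ : e.hom.hom.right ≫ s'.hom.right = s.hom.right := congrArg (fun z => z.hom.right) he₁
  have w₃ : e.hom.hom.left ≫ t'.hom.left = t.hom.left := congrArg (fun z => z.hom.left) he₂
  have w₄ : e.hom.hom.right ≫ t'.hom.right = t.hom.right := congrArg (fun z => z.hom.right) he₂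
  refine ⟨hl.of_iso (asIso e.hom.hom.left).symm (Iso.refl _) (Iso.refl _) (Iso.refl _) ?_ ?_
    (by simp) (by simp), hr.of_iso (asIso e.hom.hom.right).symm (Iso.refl _) (Iso.refl _)
    (Iso.refl _) ?_ ?_ (by simp) (by simp), ?_⟩
  · simp [← w₁]
  · simp [← w₃]
  · simp [← w₂]
  · simp [← w₄]
  · exact he₂ ▸ (extClass_of_isIso hE e.hom inferInstance).comp hE ht

/-- The comparison of the composite, followed by a base change of `φ.hom.right`, factors as
`φ.hom.left` and then the comparison of `ψ`; (E4) for `E` applies. -/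
lemma extClass.of_comp_of_mem (hE : ExtensionClass E) {a b c : Ext E} {φ : a ⟶ b} {ψ : b ⟶ c}
    (hφ : extClass E φ) (h : extClass E (φ ≫ ψ)) : extClass E ψ := by
  have hr : E ψ.hom.right := hE.of_comp (f := φ.hom.right) h.2.1
  refine extClass.exists_comparison hE (hE.of_comp (f := φ.hom.left) h.1) hr ?_
  intro P p₁ p₂ k sq h₁ h₂
  have hp₁ : E p₁ := hE.fst sq c.property
  obtain ⟨Q, q₁, q₂, sqQ⟩ := hE.exists_pullback hp₁ φ.hom.right
  obtain ⟨m, hm₁, hm₂⟩ := sqQ.exists_lift (φ.hom.left ≫ k) a.obj.hom (by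
    rw [Category.assoc, h₁, Ext.w φ])
  have hm : E m := h.comparison hE (p₁ := q₂) (p₂ := q₁ ≫ p₂) (sqQ.flip.paste_vert sq) hm₂ (by
    rw [reassoc_of% hm₁, h₂]; rfl)
  exact hE.of_comp_eq hm₁.symm (hE.comp hm (hE.fst sqQ hφ.2.1))

/-- In the pullback of `φ ≫ ψ` along `ψ`, the morphism `φ` gives a section of the projection `s`, so
`s` is in the class by (E5) for `E`. Then so is `s ≫ φ ≫ ψ = t ≫ ψ`, and `t` can be cancelled. -/
lemma extClass_condE4 (hE : ExtensionClass E) : CondE4 (extClass E) := by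
  intro a b c φ ψ h
  obtain ⟨p, s, t, hl, hr, ht⟩ := h.exists_levelwise_pullback hE ψ
  have sq := Ext.isPullback hl hr
  obtain ⟨σ, hσ, -⟩ := sq.exists_lift (𝟙 a) φ (by simp)
  have hs : extClass E s := hE.e5 s ⟨⟨σ, hσ⟩⟩
  have : extClass E (t ≫ ψ) := by
    rw [← sq.w]
    exact hs.comp hE h
  exact ht.of_comp_of_mem hE this

lemma extClass_condE5 (hE : ExtensionClass E) : CondE5 (extClass E) := by
  intro a b φ hφ
  obtain ⟨⟨σ, hσ⟩⟩ := hφ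
  have wφ : φ.hom.left ≫ b.obj.hom = a.obj.hom ≫ φ.hom.right := Arrow.w φ.hom
  have wσ : σ.hom.left ≫ a.obj.hom = b.obj.hom ≫ σ.hom.right := Arrow.w σ.hom
  have hσl : σ.hom.left ≫ φ.hom.left = 𝟙 _ := congrArg (fun z => z.hom.left) hσ
  have hσr : σ.hom.right ≫ φ.hom.right = 𝟙 _ := congrArg (fun z => z.hom.right) hσ
  have hφl : extClass E φ.hom.left := hE.e5 _ ⟨⟨_, hσl⟩⟩
  have hφr : extClass E φ.hom.right := hE.e5 _ ⟨⟨_, hσr⟩⟩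
  obtain ⟨p, s, t, hl, hr, ht⟩ := hφr.exists_levelwise_pullback hE b.obj.hom
  have sq := Ext.isPullback hl hr
  obtain ⟨k, hk₁, hk₂⟩ := sq.exists_lift a.obj.hom φ.hom.left wφ.symm
  refine ⟨hφl, hφr, p, s, t, k, sq, hk₁, hk₂, ?_⟩
  have wφl : φ.hom.left.hom.left ≫ b.obj.hom.hom.left = a.obj.hom.hom.left ≫ φ.hom.right.hom.left :=
    congrArg (fun z => z.hom.left) wφ
  have wφr : φ.hom.left.hom.right ≫ b.obj.hom.hom.right =
      a.obj.hom.hom.right ≫ φ.hom.right.hom.right := congrArg (fun z => z.hom.right) wφ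
  have wσl : σ.hom.left.hom.left ≫ a.obj.hom.hom.left = b.obj.hom.hom.left ≫ σ.hom.right.hom.left :=
    congrArg (fun z => z.hom.left) wσ
  have wσr : σ.hom.left.hom.right ≫ a.obj.hom.hom.right =
      b.obj.hom.hom.right ≫ σ.hom.right.hom.right := congrArg (fun z => z.hom.right) wσ
  have hσll : σ.hom.left.hom.left ≫ φ.hom.left.hom.left = 𝟙 _ :=
    congrArg (fun z => z.hom.left) hσl
  have hσlr : σ.hom.left.hom.right ≫ φ.hom.left.hom.right = 𝟙 _ :=
    congrArg (fun z => z.hom.right) hσl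
  have hσrl : σ.hom.right.hom.left ≫ φ.hom.right.hom.left = 𝟙 _ :=
    congrArg (fun z => z.hom.left) hσr
  have hσrr : σ.hom.right.hom.right ≫ φ.hom.right.hom.right = 𝟙 _ :=
    congrArg (fun z => z.hom.right) hσr
  have hkl₁ : k.hom.left ≫ s.hom.left = a.obj.hom.hom.left := congrArg (fun z => z.hom.left) hk₁
  have hkl₂ : k.hom.left ≫ t.hom.left = φ.hom.left.hom.left := congrArg (fun z => z.hom.left) hk₂
  have hkr₁ : k.hom.right ≫ s.hom.right = a.obj.hom.hom.right :=
    congrArg (fun z => z.hom.right) hk₁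
  have hkr₂ : k.hom.right ≫ t.hom.right = φ.hom.left.hom.right :=
    congrArg (fun z => z.hom.right) hk₂
  -- The first two goals concern the domain and codomain faces of the cube. Read in the transposed
  -- direction, each face is a split epimorphism of `Ext E`, so (E5) for `E` gives its comparison.
  refine extClass.exists_comparison hE ?_ ?_ ?_
  · let Φ : Ext.mk _ a.property.1 ⟶ Ext.mk _ b.property.1 :=
      Ext.homMk a.property.1 b.property.1 φ.hom.left.hom.left φ.hom.right.hom.left wφl
    let S : Ext.mk _ b.property.1 ⟶ Ext.mk _ a.property.1 :=
      Ext.homMk b.property.1 a.property.1 σ.hom.left.hom.left σ.hom.right.hom.left wσl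
    have : extClass E Φ := hE.e5 _ ⟨⟨S, Ext.hom_ext hσll hσrl⟩⟩
    exact this.comparison hE hl hkl₁ hkl₂
  · let Φ : Ext.mk _ a.property.2.1 ⟶ Ext.mk _ b.property.2.1 :=
      Ext.homMk a.property.2.1 b.property.2.1 φ.hom.left.hom.right φ.hom.right.hom.right wφr
    let S : Ext.mk _ b.property.2.1 ⟶ Ext.mk _ a.property.2.1 :=
      Ext.homMk b.property.2.1 a.property.2.1 σ.hom.left.hom.right σ.hom.right.hom.right wσr
    have : extClass E Φ := hE.e5 _ ⟨⟨S, Ext.hom_ext hσlr hσrr⟩⟩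
    exact this.comparison hE hr hkr₁ hkr₂
  · intro Q q₁ q₂ l sqQ hl₁ hl₂
    obtain ⟨-, -, U, u₁, u₂, ka, sqU, hka₁, hka₂, hka⟩ := a.property
    obtain ⟨-, -, V, v₁, v₂, kb, sqV, hkb₁, hkb₂, hkb⟩ := b.property
    obtain ⟨m, hm₁, hm₂⟩ := sqV.exists_lift (u₁ ≫ φ.hom.left.hom.right)
      (u₂ ≫ φ.hom.right.hom.left) (by
        rw [Category.assoc, Category.assoc, wφr, reassoc_of% sqU.w, Ext.w φ.hom.right])
    obtain ⟨n, hn₁, hn₂⟩ := sqU.exists_lift (v₁ ≫ σ.hom.left.hom.right)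
      (v₂ ≫ σ.hom.right.hom.left) (by
        rw [Category.assoc, Category.assoc, wσr, reassoc_of% sqV.w, Ext.w σ.hom.right])
    let Φ : Ext.mk ka hka ⟶ Ext.mk kb hkb := Ext.homMk hka hkb φ.hom.left.hom.left m (by
      apply sqV.hom_ext
      · rw [Category.assoc, Category.assoc, hkb₁, hm₁, reassoc_of% hka₁, Ext.w φ.hom.left]
      · rw [Category.assoc, Category.assoc, hkb₂, hm₂, reassoc_of% hka₂, wφl])
    let S : Ext.mk kb hkb ⟶ Ext.mk ka hka := Ext.homMk hkb hka σ.hom.left.hom.left n (by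
      apply sqU.hom_ext
      · rw [Category.assoc, Category.assoc, hka₁, hn₁, reassoc_of% hkb₁, Ext.w σ.hom.left]
      · rw [Category.assoc, Category.assoc, hka₂, hn₂, reassoc_of% hkb₂, wσl])
    have hnm : n ≫ m = 𝟙 V := by
      apply sqV.hom_ext
      · rw [Category.assoc, hm₁, reassoc_of% hn₁, hσlr]; simp
      · rw [Category.assoc, hm₂, reassoc_of% hn₂, hσrl]; simp
    have hΦ : extClass E Φ := hE.e5 _ ⟨⟨S, Ext.hom_ext hσll hnm⟩⟩
    obtain ⟨j, hj₁, hj₂⟩ := sqU.exists_lift q₁ (q₂ ≫ s.hom.left) (by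
      rw [← hkr₁, reassoc_of% sqQ.w, Category.assoc, Ext.w s])
    -- `Q` is the limit of the cube without its initial vertex. Computed in the other order it is
    -- the pullback of `m` along `kb`, so `l` is the comparison of the split epimorphism `Φ`.
    have sqj : IsPullback j (q₂ ≫ t.hom.left) m kb := by
      refine IsPullback.mk' ?_ ?_ ?_
      · apply sqV.hom_ext
        · rw [Category.assoc, Category.assoc, hm₁, reassoc_of% hj₁, hkb₁, ← hkr₂,
            reassoc_of% sqQ.w, Category.assoc, Ext.w t]
        · rw [Category.assoc, Category.assoc, hm₂, reassoc_of% hj₂, hkb₂, Category.assoc, hl.w]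
      · intro T x y hx hy
        apply sqQ.hom_ext
        · rw [← hj₁, reassoc_of% hx]
        · apply hl.hom_ext
          · rw [Category.assoc, Category.assoc, ← hj₂, reassoc_of% hx]
          · rw [Category.assoc, Category.assoc, hy]
      · intro T x y hxy
        obtain ⟨z, hz₁, hz₂⟩ := hl.exists_lift (x ≫ u₂) y (by
          rw [Category.assoc, ← hm₂, reassoc_of% hxy, hkb₂])
        obtain ⟨c, hc₁, hc₂⟩ := sqQ.exists_lift (x ≫ u₁) z (by
          apply hr.hom_ext
          · rw [Category.assoc, Category.assoc, Category.assoc, hkr₁, ← Ext.w s,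
              reassoc_of% hz₁, sqU.w]
          · rw [Category.assoc, Category.assoc, Category.assoc, hkr₂, ← Ext.w t,
              reassoc_of% hz₂, ← hm₁, reassoc_of% hxy, hkb₁])
        refine ⟨c, sqU.hom_ext ?_ ?_, ?_⟩
        · rw [Category.assoc, hj₁, hc₁]
        · rw [Category.assoc, hj₂, reassoc_of% hc₂, hz₁]
        · rw [reassoc_of% hc₂, hz₂]
    refine hΦ.comparison hE sqj ?_ ?_
    · apply sqU.hom_ext
      · rw [Category.assoc, hj₁, hl₁]; exact hka₁.symm
      · rw [Category.assoc, hj₂, reassoc_of% hl₂, hkl₁]; exact hka₂.symm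
    · rw [reassoc_of% hl₂, hkl₂]; rfl

/-- The conditions (E1)-(E5) pass from a class `E` to the class `extClass E`. -/
lemma ExtensionClass.extClass (hE : ExtensionClass E) : ExtensionClass (extClass E) where
  e1 _ _ φ hφ := extClass_of_isIso hE φ hφ
  hasPullbacks := ⟨fun ψ hφ =>
    let ⟨_, _, _, hl, hr, _⟩ := extClass.exists_levelwise_pullback hE hφ ψ
    (Ext.isPullback hl hr).hasPullback⟩
  stable := ⟨fun sq hφ => (extClass.isPullback_levelwise hE sq hφ).2.2⟩
  comp _ _ _ _ _ hφ hψ := hφ.comp hE hψ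
  e4 := extClass_condE4 hE
  e5 := extClass_condE5 hE

end ExtensionClass

/-! ### Beck's criterion in terms of pullback squares. -/

section Monadicity

variable {C : Type u} [Category.{v} C] {E : MorphismProperty C}

/-- The pullback functor along a morphism, for a class of morphisms subject to (E1)-(E5). -/
noncomputable def ExtensionClass.pullbackFunctor (hE : ExtensionClass E) {T B : C} (p : T ⟶ B) :
    E.Over ⊤ B ⥤ E.Over ⊤ T :=
  haveI := hE.hasPullbacks
  haveI := hE.stable
  MorphismProperty.Over.pullback E ⊤ p

/-- The projection from the pullback of `X` along `p` to `X`. -/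
noncomputable def ExtensionClass.pullbackFst (hE : ExtensionClass E) {T B : C} (p : T ⟶ B)
    (X : E.Over ⊤ B) : ((hE.pullbackFunctor p).obj X).left ⟶ X.left :=
  haveI := hE.hasPullbacks
  pullback.fst X.hom p

lemma ExtensionClass.isPullback_pullbackFunctor (hE : ExtensionClass E) {T B : C} (p : T ⟶ B)
    (X : E.Over ⊤ B) :
    IsPullback (P := ((hE.pullbackFunctor p).obj X).left) (X := X.left) (Y := T) (Z := B)
      (hE.pullbackFst p X) ((hE.pullbackFunctor p).obj X).hom X.hom p :=
  have := hE.hasPullbacks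
  IsPullback.of_hasPullback X.hom p

lemma ExtensionClass.pullbackFunctor_map_fst (hE : ExtensionClass E) {T B : C} (p : T ⟶ B)
    {X Y : E.Over ⊤ B} (φ : X ⟶ Y) :
    ((hE.pullbackFunctor p).map φ).left ≫ hE.pullbackFst p Y = hE.pullbackFst p X ≫ φ.left :=
  have := hE.hasPullbacks
  pullback.lift_fst _ _ _

lemma over_w {B : C} {X Y : E.Over ⊤ B} (φ : X ⟶ Y) :
    CategoryStruct.comp (X := X.left) (Y := Y.left) (Z := B) φ.left Y.hom = X.hom :=
  MorphismProperty.Over.w φ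

lemma over_isIso_left {B : C} {X Y : E.Over ⊤ B} (φ : X ⟶ Y) (hφ : IsIso φ) : IsIso φ.left :=
  (MorphismProperty.Over.forget E ⊤ B ⋙ CategoryTheory.Over.forget B).map_isIso φ

lemma over_isIso {B : C} {X Y : E.Over ⊤ B} (φ : X ⟶ Y) (hφ : IsIso φ.left) : IsIso φ :=
  have : IsIso ((MorphismProperty.Over.forget E ⊤ B ⋙ CategoryTheory.Over.forget B).map φ) := hφ
  isIso_of_reflects_iso _ (MorphismProperty.Over.forget E ⊤ B ⋙ CategoryTheory.Over.forget B)

/-- Pulling back along `p` reflects isomorphisms between morphisms of `E`. -/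
def ReflectsIsosAlong (E : MorphismProperty C) {T B : C} (p : T ⟶ B) : Prop :=
  ∀ ⦃X Y X' Y' : C⦄ ⦃u : X ⟶ Y⦄ ⦃x : X ⟶ B⦄ ⦃y : Y ⟶ B⦄ ⦃q : X' ⟶ X⦄ ⦃x' : X' ⟶ T⦄ ⦃r : Y' ⟶ Y⦄
    ⦃y' : Y' ⟶ T⦄ ⦃u' : X' ⟶ Y'⦄, E x → E y → u ≫ y = x → IsPullback q x' x p →
    IsPullback r y' y p → u' ≫ r = q ≫ u → u' ≫ y' = x' → IsIso u' → IsIso u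

/-- Every parallel pair over `B` whose pullback along `p` has a split coequalizer in `E` over `T`
has a coequalizer in `E` over `B`, which is preserved by pulling back along `p`. -/
def CreatesSplitCoequalizersAlong (E : MorphismProperty C) {T B : C} (p : T ⟶ B) : Prop :=
  ∀ ⦃X Y X' Y' W : C⦄ ⦃x : X ⟶ B⦄ ⦃y : Y ⟶ B⦄ ⦃f g : X ⟶ Y⦄ ⦃q : X' ⟶ X⦄ ⦃x' : X' ⟶ T⦄
    ⦃r : Y' ⟶ Y⦄ ⦃y' : Y' ⟶ T⦄ ⦃f' g' : X' ⟶ Y'⦄ ⦃w : W ⟶ T⦄ ⦃π : Y' ⟶ W⦄ ⦃s : W ⟶ Y'⦄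
    ⦃t : Y' ⟶ X'⦄,
    E x → E y → f ≫ y = x → g ≫ y = x → IsPullback q x' x p → IsPullback r y' y p →
    f' ≫ r = q ≫ f → f' ≫ y' = x' → g' ≫ r = q ≫ g → g' ≫ y' = x' → E w → π ≫ w = y' →
    s ≫ y' = w → t ≫ x' = y' → f' ≫ π = g' ≫ π → s ≫ π = 𝟙 W → t ≫ g' = 𝟙 Y' → t ≫ f' = π ≫ s →
    ∃ (Z : C) (z : Z ⟶ B) (e : Y ⟶ Z) (c : W ⟶ Z), E z ∧ e ≫ z = y ∧ f ≫ e = g ≫ e ∧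
      IsPullback c w z p ∧ π ≫ c = r ≫ e ∧
      ∀ ⦃V : C⦄ (v : V ⟶ B) (k : Y ⟶ V), E v → k ≫ v = y → f ≫ k = g ≫ k →
        ∃! l : Z ⟶ V, e ≫ l = k ∧ l ≫ v = z

lemma ExtensionClass.pullbackFunctor_map_left (hE : ExtensionClass E) {T B : C} (p : T ⟶ B)
    {X Y : E.Over ⊤ B} (φ : X ⟶ Y) {X' Y' : C} {q : X' ⟶ X.left} {x' : X' ⟶ T} {r : Y' ⟶ Y.left}
    {y' : Y' ⟶ T} (sqX : IsPullback (X := X.left) (Y := T) (Z := B) q x' X.hom p)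
    (sqY : IsPullback (X := Y.left) (Y := T) (Z := B) r y' Y.hom p) {u' : X' ⟶ Y'}
    (h₁ : u' ≫ r = q ≫ φ.left) (h₂ : u' ≫ y' = x') :
    ((hE.pullbackFunctor p).map φ).left =
      (sqX.isoIsPullback _ _ (hE.isPullback_pullbackFunctor p X)).inv ≫ u' ≫
        (sqY.isoIsPullback _ _ (hE.isPullback_pullbackFunctor p Y)).hom := by
  apply (hE.isPullback_pullbackFunctor p Y).hom_ext
  · rw [hE.pullbackFunctor_map_fst]
    simp [h₁]
  · rw [over_w]
    simp [h₂]

lemma reflectsIsomorphisms_of_monadic {D₁ D₂ : Type*} [Category* D₁] [Category* D₂] (R : D₁ ⥤ D₂)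
    [MonadicRightAdjoint R] : R.ReflectsIsomorphisms where
  reflects φ hφ := by
    have : IsIso ((monadicAdjunction R).toMonad.forget.map
      ((Monad.comparison (monadicAdjunction R)).map φ)) := hφ
    have := isIso_of_reflects_iso ((Monad.comparison (monadicAdjunction R)).map φ)
      (monadicAdjunction R).toMonad.forget
    exact isIso_of_reflects_iso φ (Monad.comparison (monadicAdjunction R))

lemma isIso_of_isIso_pullback_of_monadic (hE : ExtensionClass E) {T B : C} {p : T ⟶ B}
    [MonadicRightAdjoint (hE.pullbackFunctor p)] {X Y : E.Over ⊤ B} (φ : X ⟶ Y) {X' Y' : C}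
    {q : X' ⟶ X.left} {x' : X' ⟶ T} {r : Y' ⟶ Y.left} {y' : Y' ⟶ T}
    (sqX : IsPullback (X := X.left) (Y := T) (Z := B) q x' X.hom p)
    (sqY : IsPullback (X := Y.left) (Y := T) (Z := B) r y' Y.hom p) {u' : X' ⟶ Y'}
    (h₁ : u' ≫ r = q ≫ φ.left) (h₂ : u' ≫ y' = x') (hu' : IsIso u') : IsIso φ.left := by
  have hφ' : IsIso ((hE.pullbackFunctor p).map φ) :=
    over_isIso _ (by rw [hE.pullbackFunctor_map_left p φ sqX sqY h₁ h₂]; infer_instance)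
  have := reflectsIsomorphisms_of_monadic (hE.pullbackFunctor p)
  exact over_isIso_left φ (isIso_of_reflects_iso φ (hE.pullbackFunctor p))

lemma reflectsIsosAlong_of_monadic (hE : ExtensionClass E) {T B : C} {p : T ⟶ B}
    (hp : Nonempty (MonadicRightAdjoint (hE.pullbackFunctor p))) : ReflectsIsosAlong E p := by
  obtain ⟨hp⟩ := hp
  intro X Y X' Y' u x y q x' r y' u' hx hy hu sqX sqY h₁ h₂ hu'
  exact isIso_of_isIso_pullback_of_monadic hE
    (MorphismProperty.Over.homMk u hu :
      MorphismProperty.Over.mk ⊤ x hx ⟶ MorphismProperty.Over.mk ⊤ y hy) sqX sqY h₁ h₂ hu'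

lemma exists_coequalizer_of_monadic (hE : ExtensionClass E) {T B : C} {p : T ⟶ B}
    [MonadicRightAdjoint (hE.pullbackFunctor p)] {Xo Yo : E.Over ⊤ B} (F G : Xo ⟶ Yo)
    {X' Y' : C} {q : X' ⟶ Xo.left} {x' : X' ⟶ T} {r : Y' ⟶ Yo.left} {y' : Y' ⟶ T}
    {f' g' : X' ⟶ Y'} {Wo : E.Over ⊤ T} {π : Y' ⟶ Wo.left} {s : Wo.left ⟶ Y'} {t : Y' ⟶ X'}
    (sqX : IsPullback (X := Xo.left) (Y := T) (Z := B) q x' Xo.hom p)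
    (sqY : IsPullback (X := Yo.left) (Y := T) (Z := B) r y' Yo.hom p)
    (hfr : f' ≫ r = q ≫ F.left) (hfy : f' ≫ y' = x') (hgr : g' ≫ r = q ≫ G.left)
    (hgy : g' ≫ y' = x') (hπ : CategoryStruct.comp (Z := T) π Wo.hom = y') (hs : s ≫ y' = Wo.hom)
    (ht : t ≫ x' = y') (hfg : f' ≫ π = g' ≫ π) (hsπ : s ≫ π = 𝟙 Wo.left)
    (htg : t ≫ g' = 𝟙 Y') (htf : t ≫ f' = π ≫ s) :
    ∃ (Z : E.Over ⊤ B) (e : Yo ⟶ Z) (c : Wo.left ⟶ Z.left), F ≫ e = G ≫ e ∧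
      IsPullback (X := Z.left) (Y := T) (Z := B) c Wo.hom Z.hom p ∧ π ≫ c = r ≫ e.left ∧
      ∀ ⦃V : E.Over ⊤ B⦄ (k : Yo ⟶ V), F ≫ k = G ≫ k → ∃! l : Z ⟶ V, e ≫ l = k := by
  let R := hE.pullbackFunctor p
  have sqX' := hE.isPullback_pullbackFunctor p Xo
  have sqY' := hE.isPullback_pullbackFunctor p Yo
  let i := sqX.isoIsPullback _ _ sqX'
  let j := sqY.isoIsPullback _ _ sqY'
  have hF : (R.map F).left = i.inv ≫ f' ≫ j.hom :=
    hE.pullbackFunctor_map_left p F sqX sqY hfr hfy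
  have hG : (R.map G).left = i.inv ≫ g' ≫ j.hom :=
    hE.pullbackFunctor_map_left p G sqX sqY hgr hgy
  have hY : j.hom ≫ (R.obj Yo).hom = y' := sqY.isoIsPullback_hom_snd _ _ sqY'
  have hX : i.hom ≫ (R.obj Xo).hom = x' := sqX.isoIsPullback_hom_snd _ _ sqX'
  have hY' : j.inv ≫ y' = (R.obj Yo).hom := sqY.isoIsPullback_inv_snd _ _ sqY'
  let Q : R.obj Yo ⟶ Wo := MorphismProperty.Over.homMk (j.inv ≫ π) (by
    rw [← hY', Category.assoc]; exact congrArg _ hπ)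
  let S : Wo ⟶ R.obj Yo := MorphismProperty.Over.homMk (s ≫ j.hom) (by
    rw [Category.assoc, hY]; exact hs)
  let U : R.obj Yo ⟶ R.obj Xo :=
    MorphismProperty.Over.homMk (j.inv ≫ t ≫ i.hom) (by
      rw [Category.assoc, Category.assoc, hX, ht, hY'])
  -- The given splitting lives on arbitrary pullbacks; `i` and `j` transport it to those chosen by
  -- the functor.
  have split : IsSplitCoequalizer (R.map F) (R.map G) Q :=
    { rightSection := S
      leftSection := U
      condition := by
        ext
        change (R.map F).left ≫ _ = (R.map G).left ≫ _
        rw [hF, hG]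
        simp [Q, hfg]
      rightSection_π := by
        ext
        change (s ≫ j.hom) ≫ j.inv ≫ π = 𝟙 Wo.left
        simp [hsπ]
      leftSection_bottom := by
        ext
        change (j.inv ≫ t ≫ i.hom) ≫ (R.map G).left = 𝟙 _
        rw [hG]
        simp [reassoc_of% htg]
      leftSection_top := by
        ext
        change (j.inv ≫ t ≫ i.hom) ≫ (R.map F).left =
          (j.inv ≫ π) ≫ (s ≫ j.hom)
        rw [hF]
        simp [reassoc_of% htf] }
  have hsp : R.IsSplitPair F G := ⟨_, _, ⟨split⟩⟩
  have hcr : CreatesColimit (parallelPair F G) R :=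
    Monad.createsGSplitCoequalizersOfMonadic R F G
  have hhc : HasCoequalizer (R.map F) (R.map G) := inferInstance
  have : HasColimit (parallelPair F G ⋙ R) :=
    (hasColimit_iff_of_iso (diagramIsoParallelPair.{v} _)).2 hhc
  have : HasCoequalizer F G := hasColimit_of_created (parallelPair F G) R
  let e := coequalizer.π F G
  let hcol := isColimitOfHasCoequalizerOfPreservesColimit R F G
  let Z := coequalizer F G
  let θ : Wo ≅ R.obj Z := IsColimit.coconePointUniqueUpToIso split.isCoequalizer hcol
  have hi : Q ≫ θ.hom = R.map e :=
    IsColimit.comp_coconePointUniqueUpToIso_hom split.isCoequalizer hcol WalkingParallelPair.one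
  let il : Wo.left ≅ (R.obj Z).left :=
    (MorphismProperty.Over.forget E ⊤ T ⋙ CategoryTheory.Over.forget T).mapIso θ
  have hil : (j.inv ≫ π) ≫ il.hom = (R.map e).left :=
    congrArg (fun k => k.left) hi
  have wi : il.hom ≫ (R.obj Z).hom = Wo.hom := MorphismProperty.Over.w θ.hom
  refine ⟨Z, e, il.hom ≫ hE.pullbackFst p Z, coequalizer.condition F G, ?_, ?_, ?_⟩
  · refine (hE.isPullback_pullbackFunctor p Z).of_iso il.symm (Iso.refl _) (Iso.refl _)
      (Iso.refl _) ?_ ?_ ?_ ?_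
    · simp
    · rw [← wi]; simp [R]
    · simp
    · simp
  · have h₁ : π = j.hom ≫ (j.inv ≫ π) := by simp
    rw [h₁, Category.assoc, ← Category.assoc (j.inv ≫ π) il.hom, hil, hE.pullbackFunctor_map_fst]
    exact sqY.isoIsPullback_hom_fst_assoc _ _ sqY' _
  · intro V K hK
    exact ⟨coequalizer.desc K hK, coequalizer.π_desc K hK, fun l hl =>
      coequalizer.hom_ext (hl.trans (coequalizer.π_desc K hK).symm)⟩

lemma createsSplitCoequalizersAlong_of_monadic (hE : ExtensionClass E) {T B : C} {p : T ⟶ B}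
    (hp : Nonempty (MonadicRightAdjoint (hE.pullbackFunctor p))) :
    CreatesSplitCoequalizersAlong E p := by
  obtain ⟨hp⟩ := hp
  intro X Y X' Y' W x y f g q x' r y' f' g' w π s t hx hy hf hg sqX sqY hfr hfy hgr hgy hw hπ hs ht
    hfg hsπ htg htf
  let Xo := MorphismProperty.Over.mk (P := E) ⊤ x hx
  let Yo := MorphismProperty.Over.mk (P := E) ⊤ y hy
  let Wo := MorphismProperty.Over.mk (P := E) ⊤ w hw
  obtain ⟨Z, e, c, he, sq, hc, hu⟩ := exists_coequalizer_of_monadic hE (Wo := Wo)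
    (MorphismProperty.Over.homMk f hf : Xo ⟶ Yo) (MorphismProperty.Over.homMk g hg : Xo ⟶ Yo)
    sqX sqY hfr hfy hgr hgy hπ hs ht hfg hsπ htg htf
  refine ⟨Z.left, Z.hom, e.left, c, Z.prop, over_w e, congrArg (fun k => k.left) he, sq, hc, ?_⟩
  intro V v k hv hk hfk
  obtain ⟨l, hl, hl'⟩ := hu (V := .mk ⊤ v hv) (MorphismProperty.Over.homMk k hk) (by ext; exact hfk)
  refine ⟨l.left, ⟨congrArg (fun k => k.left) hl, over_w l⟩, fun m hm => ?_⟩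
  exact congrArg (fun k => k.left) (hl' (MorphismProperty.Over.homMk m hm.2) (by ext; exact hm.1))

/-- Beck's monadicity theorem, with composition with `p` as left adjoint. -/
lemma monadic_of_createsSplitCoequalizersAlong (hE : ExtensionClass E) {T B : C} {p : T ⟶ B}
    (hp : E p) (hr : ReflectsIsosAlong E p) (hc : CreatesSplitCoequalizersAlong E p) :
    Nonempty (MonadicRightAdjoint (hE.pullbackFunctor p)) := by
  have := hE.hasPullbacks
  have := hE.stable
  have : E.IsStableUnderComposition := ⟨fun _ _ hf hg => hE.comp hf hg⟩
  let R := hE.pullbackFunctor p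
  let adj : MorphismProperty.Over.map ⊤ hp ⊣ R := MorphismProperty.Over.mapPullbackAdj E ⊤ p hp
    trivial
  have : R.ReflectsIsomorphisms := ⟨fun {X Y} φ hφ => over_isIso φ <|
    hr X.prop Y.prop (over_w φ) (hE.isPullback_pullbackFunctor p X)
      (hE.isPullback_pullbackFunctor p Y) (hE.pullbackFunctor_map_fst p φ) (over_w (R.map φ))
      (over_isIso_left _ hφ)⟩
  have key : ∀ {X Y : E.Over ⊤ B} (F G : X ⟶ Y) [R.IsSplitPair F G],
      ∃ (c : Cofork F G), Nonempty (IsColimit c) ∧ Nonempty (IsColimit (R.mapCocone c)) := by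
    intro X Y F G hs
    obtain ⟨W, Q, ⟨split⟩⟩ := hs.splittable
    obtain ⟨Z, z, e, c, hz, hez, hfe, sqc, hπc, hu⟩ := hc X.prop Y.prop (MorphismProperty.Over.w F)
      (MorphismProperty.Over.w G) (hE.isPullback_pullbackFunctor p X)
      (hE.isPullback_pullbackFunctor p Y) (hE.pullbackFunctor_map_fst p F)
      (MorphismProperty.Over.w (R.map F)) (hE.pullbackFunctor_map_fst p G)
      (MorphismProperty.Over.w (R.map G)) W.prop (MorphismProperty.Over.w Q)
      (MorphismProperty.Over.w split.rightSection) (MorphismProperty.Over.w split.leftSection)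
      (congrArg (fun k => k.left) split.condition)
      (congrArg (fun k => k.left) split.rightSection_π)
      (congrArg (fun k => k.left) split.leftSection_bottom)
      (congrArg (fun k => k.left) split.leftSection_top)
    let Zo := MorphismProperty.Over.mk (P := E) ⊤ z hz
    let e' : Y ⟶ Zo := MorphismProperty.Over.homMk e hez
    have he' : F ≫ e' = G ≫ e' := by ext; exact hfe
    have sqZ := hE.isPullback_pullbackFunctor p Zo
    let i : W ≅ R.obj Zo := MorphismProperty.Over.isoMk (sqc.isoIsPullback _ _ sqZ)
      (sqc.isoIsPullback_hom_snd _ _ sqZ)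
    have hi : R.map e' = Q ≫ i.hom := by
      ext
      change (R.map e').left = Q.left ≫ (sqc.isoIsPullback _ _ sqZ).hom
      apply sqZ.hom_ext
      · rw [hE.pullbackFunctor_map_fst, Category.assoc]
        exact hπc.symm.trans (congrArg (Q.left ≫ ·) (sqc.isoIsPullback_hom_fst _ _ sqZ).symm)
      · rw [over_w, Category.assoc]
        exact (over_w Q).symm.trans
          (congrArg (Q.left ≫ ·) (sqc.isoIsPullback_hom_snd _ _ sqZ).symm)
    -- Up to the isomorphism `i`, `R.map e'` is the split coequalizer `Q`; being split, it is a
    -- coequalizer, so `R` preserves the colimit.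
    have split' : IsSplitCoequalizer (R.map F) (R.map G) (R.map e') :=
      { rightSection := i.inv ≫ split.rightSection
        leftSection := split.leftSection
        condition := by rw [← R.map_comp, he', R.map_comp]
        rightSection_π := by rw [hi]; simp
        leftSection_bottom := split.leftSection_bottom
        leftSection_top := by rw [hi]; simp }
    refine ⟨Cofork.ofπ e' he', ⟨Cofork.IsColimit.mk' _ fun s => ?_⟩,
      ⟨(isColimitMapCoconeCoforkEquiv R he').symm split'.isCoequalizer⟩⟩
    have hs := hu s.pt.hom s.π.left s.pt.prop (MorphismProperty.Over.w s.π)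
      (congrArg (fun k => k.left) s.condition)
    refine ⟨MorphismProperty.Over.homMk hs.choose hs.choose_spec.1.2, ?_, ?_⟩
    · ext; exact hs.choose_spec.1.1
    · intro m hm
      ext
      exact hs.choose_spec.2 m.left
        ⟨congrArg (fun k => k.left) hm, MorphismProperty.Over.w m⟩
  have : Monad.HasCoequalizerOfIsSplitPair R := ⟨fun F G _ =>
    let ⟨_, ⟨h⟩, _⟩ := key F G
    ⟨⟨_, h⟩⟩⟩
  have : Monad.PreservesColimitOfIsSplitPair R := ⟨fun F G _ => by
    obtain ⟨_, ⟨h⟩, ⟨h'⟩⟩ := key F G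
    exact preservesColimit_of_preserves_colimit_cocone h h'⟩
  exact ⟨Monad.monadicOfHasPreservesGSplitCoequalizersOfReflectsIsomorphisms adj⟩

end Monadicity

/-! ### Monadicity for squares, from domains and codomains. -/

section ExtMonadicity

variable {C : Type u} [Category.{v} C] {E : MorphismProperty C}

lemma Ext.congr_left {a b : Ext E} {φ ψ : a ⟶ b} (h : φ = ψ) : φ.hom.left = ψ.hom.left := by
  rw [h]

lemma Ext.congr_right {a b : Ext E} {φ ψ : a ⟶ b} (h : φ = ψ) : φ.hom.right = ψ.hom.right := by
  rw [h]

lemma ReflectsIsosAlong.ext (hE : ExtensionClass E) {e b : Ext E} {p : e ⟶ b}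
    (hl : ReflectsIsosAlong E p.hom.left) (hr : ReflectsIsosAlong E p.hom.right) :
    ReflectsIsosAlong (extClass E) p := by
  intro X Y X' Y' u x y q x' r y' u' hx hy hu sqX sqY h₁ h₂ hu'
  obtain ⟨sqXl, sqXr, -⟩ := extClass.isPullback_levelwise hE sqX hx
  obtain ⟨sqYl, sqYr, -⟩ := extClass.isPullback_levelwise hE sqY hy
  exact Ext.isIso u
    (hl hx.1 hy.1 (Ext.congr_left hu) sqXl sqYl (Ext.congr_left h₁) (Ext.congr_left h₂)
      (Ext.isIso_left u' hu'))
    (hr hx.2.1 hy.2.1 (Ext.congr_right hu) sqXr sqYr (Ext.congr_right h₁) (Ext.congr_right h₂)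
      (Ext.isIso_right u' hu'))

lemma CreatesSplitCoequalizersAlong.ext (hE : ExtensionClass E) {e₀ b : Ext E} {p : e₀ ⟶ b}
    (hp : extClass E p) (hl : CreatesSplitCoequalizersAlong E p.hom.left)
    (hr : CreatesSplitCoequalizersAlong E p.hom.right) :
    CreatesSplitCoequalizersAlong (extClass E) p := by
  intro X Y X' Y' W x y f g q x' r y' f' g' w π s t hx hy hf hg sqX sqY hfr hfy hgr hgy hw hπ hs ht
    hfg hsπ htg htf
  obtain ⟨sqXl, sqXr, -⟩ := extClass.isPullback_levelwise hE sqX hx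
  obtain ⟨sqYl, sqYr, -⟩ := extClass.isPullback_levelwise hE sqY hy
  obtain ⟨Zl, zl, el, cl, hzl, hezl, hfel, sql, hcl, hul⟩ := hl hx.1 hy.1 (Ext.congr_left hf)
    (Ext.congr_left hg) sqXl sqYl (Ext.congr_left hfr) (Ext.congr_left hfy) (Ext.congr_left hgr)
    (Ext.congr_left hgy) hw.1 (Ext.congr_left hπ) (Ext.congr_left hs) (Ext.congr_left ht)
    (Ext.congr_left hfg) (Ext.congr_left hsπ) (Ext.congr_left htg) (Ext.congr_left htf)
  obtain ⟨Zr, zr, er, cr, hzr, hezr, hfer, sqr, hcr, hur⟩ := hr hx.2.1 hy.2.1 (Ext.congr_right hf)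
    (Ext.congr_right hg) sqXr sqYr (Ext.congr_right hfr) (Ext.congr_right hfy) (Ext.congr_right hgr)
    (Ext.congr_right hgy) hw.2.1 (Ext.congr_right hπ) (Ext.congr_right hs) (Ext.congr_right ht)
    (Ext.congr_right hfg) (Ext.congr_right hsπ) (Ext.congr_right htg) (Ext.congr_right htf)
  have wf := Ext.w f
  have wg := Ext.w g
  -- The coequalizer `Zl` is only universal for objects of `E` over `b.obj.left`, so `Zr` must be
  -- pulled back there before a morphism `Zl ⟶ Zr` can be induced.
  obtain ⟨V, v₁, v₂, sqV⟩ := hE.exists_pullback hzr b.obj.hom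
  obtain ⟨k, hk₁, hk₂⟩ := sqV.exists_lift (Y.obj.hom ≫ er) y.hom.left (by
    rw [Category.assoc, hezr, Ext.w y])
  obtain ⟨l, ⟨hl₁, hl₂⟩, -⟩ := hul v₂ k (hE.snd sqV hzr) hk₂ (by
    apply sqV.hom_ext
    · rw [Category.assoc, Category.assoc, hk₁, reassoc_of% wf, reassoc_of% wg, hfer]
    · rw [Category.assoc, Category.assoc, hk₂]
      exact (Ext.congr_left hf).trans (Ext.congr_left hg).symm)
  have hζe : el ≫ l ≫ v₁ = Y.obj.hom ≫ er := by rw [reassoc_of% hl₁, hk₁]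
  have hζz : (l ≫ v₁) ≫ zr = zl ≫ b.obj.hom := by
    rw [Category.assoc, sqV.w, reassoc_of% hl₂]
  have hsl : s.hom.left ≫ π.hom.left = 𝟙 _ := Ext.congr_left hsπ
  have hsr : s.hom.right ≫ π.hom.right = 𝟙 _ := Ext.congr_right hsπ
  have hcl' : cl = s.hom.left ≫ r.hom.left ≫ el := by rw [← hcl, reassoc_of% hsl]
  have hcr' : cr = s.hom.right ≫ r.hom.right ≫ er := by rw [← hcr, reassoc_of% hsr]
  have ws := Ext.w s
  have wr := Ext.w r
  have hζc : cl ≫ l ≫ v₁ = W.obj.hom ≫ cr := by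
    rw [hcl', hcr', Category.assoc, Category.assoc, hζe, reassoc_of% wr, reassoc_of% ws]
  have hζ : E (l ≫ v₁) :=
    hE.of_comp_eq hζc (hE.comp W.property (hE.fst sqr hp.2.1))
  let Z : Ext E := Ext.mk (l ≫ v₁) hζ
  let z : Z ⟶ b := ObjectProperty.homMk (Arrow.homMk zl zr hζz.symm)
  let e : Y ⟶ Z := ObjectProperty.homMk (Arrow.homMk el er hζe)
  let c : W ⟶ Z := ObjectProperty.homMk (Arrow.homMk cl cr hζc)
  have sq : IsPullback c w z p := Ext.isPullback sql sqr
  have hz : extClass E z := hE.extClass.of_comp_eq sq.w (hE.extClass.comp hw hp)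
  refine ⟨Z, z, e, c, hz, Ext.hom_ext hezl hezr, Ext.hom_ext hfel hfer, sq, Ext.hom_ext hcl hcr, ?_⟩
  intro V v k hv hkv hfk
  obtain ⟨m, ⟨hm₁, hm₂⟩, hmu⟩ := hul v.hom.left k.hom.left hv.1 (Ext.congr_left hkv)
    (Ext.congr_left hfk)
  obtain ⟨n, ⟨hn₁, hn₂⟩, hnu⟩ := hur v.hom.right k.hom.right hv.2.1 (Ext.congr_right hkv)
    (Ext.congr_right hfk)
  have wk := Ext.w k
  have wv := Ext.w v
  -- For the same reason, the compatibility of `m` and `n` is tested in a pullback over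
  -- `b.obj.left`.
  obtain ⟨U, u₁, u₂, sqU⟩ := hE.exists_pullback hv.2.1 b.obj.hom
  obtain ⟨m', hm'₁, hm'₂⟩ := sqU.exists_lift (m ≫ V.obj.hom) zl (by
    rw [Category.assoc, ← wv, reassoc_of% hm₂])
  obtain ⟨n', hn'₁, hn'₂⟩ := sqU.exists_lift ((l ≫ v₁) ≫ n) zl (by
    rw [Category.assoc, hn₂, hζz])
  have hw₂ : m' = n' := by
    refine (hul u₂ (el ≫ m') (hE.snd sqU hv.2.1) ?_ ?_).unique ⟨rfl, hm'₂⟩ ⟨?_, hn'₂⟩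
    · rw [Category.assoc, hm'₂, hezl]
    · rw [reassoc_of% hfel]
    · apply sqU.hom_ext
      · rw [Category.assoc, Category.assoc, hm'₁, hn'₁, reassoc_of% hm₁, wk, Category.assoc,
          reassoc_of% hζe, hn₁]
      · rw [Category.assoc, Category.assoc, hm'₂, hn'₂]
  have wmn : m ≫ V.obj.hom = (l ≫ v₁) ≫ n := by rw [← hm'₁, ← hn'₁, hw₂]
  refine ⟨ObjectProperty.homMk (Arrow.homMk m n wmn), ⟨Ext.hom_ext hm₁ hn₁, Ext.hom_ext hm₂ hn₂⟩,
    ?_⟩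
  rintro j ⟨hj₁, hj₂⟩
  exact Ext.hom_ext (hmu _ ⟨Ext.congr_left hj₁, Ext.congr_left hj₂⟩)
    (hnu _ ⟨Ext.congr_right hj₁, Ext.congr_right hj₂⟩)

/-- If pulling back along every morphism of `E` is monadic, then so is pulling back along every
morphism of `extClass E`. -/
lemma monadic_pullbackFunctor_ext (hE : ExtensionClass E)
    (hM : ∀ ⦃T B : C⦄ (p : T ⟶ B), E p → Nonempty (MonadicRightAdjoint (hE.pullbackFunctor p)))
    {e b : Ext E} (p : e ⟶ b) (hp : extClass E p) :
    Nonempty (MonadicRightAdjoint (hE.extClass.pullbackFunctor p)) :=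
  monadic_of_createsSplitCoequalizersAlong hE.extClass hp
    ((reflectsIsosAlong_of_monadic hE (hM _ hp.1)).ext hE
      (reflectsIsosAlong_of_monadic hE (hM _ hp.2.1)))
    ((createsSplitCoequalizersAlong_of_monadic hE (hM _ hp.1)).ext hE hp
      (createsSplitCoequalizersAlong_of_monadic hE (hM _ hp.2.1)))

end ExtMonadicity

/-! ### Descending a reflection along a monadic functor. -/

section MonadicReflection

universe v₁ u₁ u₂

variable {D₁ : Type u₁} {D₂ : Type u₂} [Category.{v₁} D₁] [Category.{v₁} D₂]

/-- Let `R` be monadic with left adjoint `L`, and let `k : R X ⟶ Y` be a reflection of `R X`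
into a class `S` of objects that is local with respect to a class `W` of morphisms preserved by
`R L`. If `k` is in `W`, then `k` lifts to a reflection of `X` into the class of those objects
that `R` sends to `S`. -/
lemma exists_reflection_of_monadic (R : D₁ ⥤ D₂) [MonadicRightAdjoint R]
    (W : MorphismProperty D₂) (S : ObjectProperty D₂)
    (hS : ∀ ⦃A B Z : D₂⦄ (f : A ⟶ B), W f → S Z → ∀ g : A ⟶ Z, ∃! g' : B ⟶ Z, f ≫ g' = g)
    (hW : ∀ ⦃A B : D₂⦄ (f : A ⟶ B), W f → W (R.map ((monadicLeftAdjoint R).map f)))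
    {X : D₁} {Y : D₂} (k : R.obj X ⟶ Y) (hk : W k) (hY : S Y) :
    ∃ (Y' : D₁) (r : X ⟶ Y') (i : R.obj Y' ≅ Y), R.map r ≫ i.hom = k ∧
      ∀ ⦃Z : D₁⦄ (h : X ⟶ Z), S (R.obj Z) → ∃! h' : Y' ⟶ Z, r ≫ h' = h := by
  let adj := monadicAdjunction R
  let M := adj.toMonad
  let K := Monad.comparison adj
  have hMk : W (M.map k) := hW _ hk
  have hMMk : W (M.map (M.map k)) := hW _ (hW _ hk)
  let AX := K.obj X
  let ax : M.obj (R.obj X) ⟶ R.obj X := AX.a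
  -- Locality with respect to `M.map k` extends the algebra structure along `k`; the algebra laws
  -- follow from uniqueness of extensions along `k` and `M.map (M.map k)`.
  obtain ⟨a, ha, -⟩ := hS _ hMk hY (ax ≫ k)
  let A : M.Algebra :=
    { A := Y
      a := a
      unit := by
        refine (hS k hk hY k).unique ?_ (Category.comp_id k)
        have h₁ := M.η.naturality k
        have h₂ : M.η.app (R.obj X) ≫ ax = 𝟙 _ := AX.unit
        dsimp at h₁
        rw [reassoc_of% h₁, ha, reassoc_of% h₂]
      assoc := by
        refine (hS _ hMMk hY _).unique rfl ?_
        have h₁ := M.μ.naturality k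
        have h₂ : M.μ.app (R.obj X) ≫ ax = M.map ax ≫ ax := AX.assoc
        dsimp at h₁
        rw [← Category.assoc, ← M.map_comp, ha, M.map_comp, Category.assoc, ha, reassoc_of% h₁, ha,
          reassoc_of% h₂] }
  let κ : AX ⟶ A := { f := k, h := ha }
  -- The comparison functor is an equivalence, so the algebra `A` and the morphism `κ` come from
  -- `D₁`.
  let Y' := K.objPreimage A
  let i : K.obj Y' ≅ A := K.objObjPreimageIso A
  obtain ⟨r, hr'⟩ : ∃ r : X ⟶ Y', K.map r = κ ≫ i.inv := K.map_surjective _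
  have hr : K.map r ≫ i.hom = κ := by rw [hr']; simp
  refine ⟨Y', r, M.forget.mapIso i, congrArg Monad.Algebra.Hom.f hr, fun Z h hZ => ?_⟩
  obtain ⟨m, hm, hmu⟩ := hS k hk hZ (R.map h)
  let c : M.obj (R.obj Z) ⟶ R.obj Z := (K.obj Z).a
  have hmc : M.map m ≫ c = a ≫ m := by
    refine (hS _ hMk hZ _).unique rfl ?_
    have h₁ : M.map (R.map h) ≫ c = ax ≫ R.map h := (K.map h).h
    rw [reassoc_of% ha, hm, ← h₁, ← Category.assoc, ← M.map_comp, hm]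
  let μ : A ⟶ K.obj Z := { f := m, h := hmc }
  have hμ : κ ≫ μ = K.map h := by
    ext
    exact hm
  obtain ⟨n, hn⟩ : ∃ n : Y' ⟶ Z, K.map n = i.hom ≫ μ := K.map_surjective _
  refine ⟨n, ?_, ?_⟩
  · apply K.map_injective
    rw [K.map_comp, hn, reassoc_of% hr, hμ]
  · intro n' hn'
    apply K.map_injective
    rw [hn, ← Iso.inv_comp_eq]
    ext
    apply hmu
    have : κ ≫ i.inv ≫ K.map n' = K.map h := by
      rw [← hn', K.map_comp, hr', Category.assoc]
    exact congrArg Monad.Algebra.Hom.f this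

end MonadicReflection

/-! ### Pullbacks and invertible comparison morphisms. -/

section PullbackLemmas

variable {C : Type u} [Category.{v} C]

lemma isPullback_of_isIso_comparison {P P' A B D : C} {f : A ⟶ B} {g : D ⟶ B} {p₁ : P ⟶ A}
    {p₂ : P ⟶ D} (sq : IsPullback p₁ p₂ f g) {k : P' ⟶ P} (hk : IsIso k) {a : P' ⟶ A} {b : P' ⟶ D}
    (ha : k ≫ p₁ = a) (hb : k ≫ p₂ = b) : IsPullback a b f g := by
  refine sq.of_iso (asIso k).symm (Iso.refl _) (Iso.refl _) (Iso.refl _) ?_ ?_ ?_ ?_ <;>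
    simp [← ha, ← hb]

lemma isIso_of_isPullback_comparison {P P' A B D : C} {f : A ⟶ B} {g : D ⟶ B} {p₁ : P ⟶ A}
    {p₂ : P ⟶ D} (sq : IsPullback p₁ p₂ f g) {k : P' ⟶ P} {a : P' ⟶ A} {b : P' ⟶ D}
    (sq' : IsPullback a b f g) (ha : k ≫ p₁ = a) (hb : k ≫ p₂ = b) : IsIso k := by
  have : k = (sq'.isoIsPullback _ _ sq).hom := by
    apply sq.hom_ext <;> simp [ha, hb]
  rw [this]
  infer_instance

end PullbackLemmas

/-! ### Trivial coverings, preservation of pullbacks, and normality of coverings. -/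

namespace GaloisStructure

variable {C : Type u} [Category.{v} C] {E : MorphismProperty C} {Γ : GaloisStructure E}

/-- The reflector, as an endofunctor of `C`. -/
def reflection (Γ : GaloisStructure E) : C ⥤ C := Γ.HI

/-- The unit of the reflection. -/
def toReflection (Γ : GaloisStructure E) (A : C) : A ⟶ Γ.reflection.obj A := Γ.η A

lemma IsTrivialCovering.isPullback {A B : C} {f : A ⟶ B} (hf : Γ.IsTrivialCovering f) :
    IsPullback (Γ.toReflection A) f (Γ.reflection.map f) (Γ.toReflection B) :=
  hf.2

lemma toReflection_naturality {A B : C} (f : A ⟶ B) :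
    Γ.toReflection A ≫ Γ.reflection.map f = f ≫ Γ.toReflection B :=
  (Γ.adj.unit.naturality f).symm

lemma isIso_reflection_map_toReflection (A : C) :
    IsIso (Γ.reflection.map (Γ.toReflection A)) := by
  have h₁ : Γ.I.map (Γ.adj.unit.app A) ≫ Γ.adj.counit.app (Γ.I.obj A) = 𝟙 (Γ.I.obj A) :=
    Γ.adj.left_triangle_components A
  have h : IsIso (Γ.I.map (Γ.adj.unit.app A)) :=
    ⟨_, h₁, by rw [← cancel_mono (Γ.adj.counit.app (Γ.I.obj A)), Category.assoc, h₁]; simp⟩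
  exact Γ.X.ι.map_isIso (Γ.I.map (Γ.adj.unit.app A))

lemma isIso_toReflection_reflection (A : C) : IsIso (Γ.toReflection (Γ.reflection.obj A)) := by
  let c : Γ.reflection.obj (Γ.reflection.obj A) ⟶ Γ.reflection.obj A :=
    Γ.X.ι.map (Γ.adj.counit.app (Γ.I.obj A))
  have hc : IsIso c := Γ.X.ι.map_isIso (Γ.adj.counit.app (Γ.I.obj A))
  have h₁ : Γ.toReflection (Γ.reflection.obj A) ≫ c = 𝟙 _ :=
    Γ.adj.right_triangle_components (Γ.I.obj A)
  exact ⟨c, h₁, by rw [← cancel_mono c, Category.assoc, h₁]; simp⟩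

lemma reflection_map_mem {A B : C} {f : A ⟶ B} (hf : E f) : E (Γ.reflection.map f) := Γ.g f hf

namespace Conditions

variable (hΓ : Γ.Conditions)
include hΓ

lemma extensionClass : ExtensionClass E where
  e1 := Γ.e1
  hasPullbacks := Γ.e2_exists
  stable := Γ.e2_stable
  comp _ _ _ f g hf hg := Γ.e3 f g hf hg
  e4 := hΓ.e4
  e5 := hΓ.e5

/-- Pulling back along a morphism of `E` reflects isomorphisms. -/
lemma isIso_of_isPullback {P A B D : C} {f : A ⟶ B} {g : D ⟶ B} {p₁ : P ⟶ A} {p₂ : P ⟶ D}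
    (sq : IsPullback p₁ p₂ f g) (hf : E f) (hg : E g) (hp : IsIso p₂) : IsIso f :=
  reflectsIsosAlong_of_monadic hΓ.extensionClass (hΓ.m g hg).2 (y := 𝟙 B) (r := g) (y' := 𝟙 D)
    hf (hΓ.extensionClass.id B) (Category.comp_id f) sq (IsPullback.of_id_snd) sq.w.symm
    (Category.comp_id p₂) hp

/-- The kernel pair of a monomorphism consists of identities, so `f` pulled back along itself is
invertible, and this is reflected by (M). -/
lemma isIso_of_mono {A B : C} {f : A ⟶ B} (hf : E f) (hm : Mono f) : IsIso f :=
  hΓ.isIso_of_isPullback (IsKernelPair.id_of_mono f) hf hf inferInstance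

lemma isIso_of_retraction {A B : C} {f : A ⟶ B} (hf : E f) {r : B ⟶ A} (hr : f ≫ r = 𝟙 A) :
    IsIso f :=
  hΓ.isIso_of_mono hf (mono_of_mono_fac hr)

lemma toReflection_mem (A : C) : E (Γ.toReflection A) := (hΓ.b (𝟙 A) (hΓ.extensionClass.id A)).1

lemma unit_comparison_mem {A B : C} {f : A ⟶ B} (hf : E f) {P : C} {p₁ : P ⟶ B}
    {p₂ : P ⟶ Γ.reflection.obj A} (sq : IsPullback p₁ p₂ (Γ.toReflection B) (Γ.reflection.map f))
    {k : A ⟶ P}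
    (h₁ : k ≫ p₁ = f) (h₂ : k ≫ p₂ = Γ.toReflection A) : E k :=
  extClass.comparison hΓ.extensionClass (hΓ.b f hf) sq h₁ h₂

lemma exists_unit_comparison {A B : C} {f : A ⟶ B} (hf : E f) :
    ∃ (P : C) (p₁ : P ⟶ B) (p₂ : P ⟶ Γ.reflection.obj A) (k : A ⟶ P),
      IsPullback p₁ p₂ (Γ.toReflection B) (Γ.reflection.map f) ∧ k ≫ p₁ = f ∧
        k ≫ p₂ = Γ.toReflection A ∧ E k := by
  obtain ⟨P, p₁, p₂, sq⟩ := hΓ.extensionClass.exists_pullback (hΓ.toReflection_mem B)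
    (Γ.reflection.map f)
  obtain ⟨k, h₁, h₂⟩ := sq.exists_lift f (Γ.toReflection A) (toReflection_naturality f).symm
  exact ⟨P, p₁, p₂, k, sq, h₁, h₂, hΓ.unit_comparison_mem hf sq h₁ h₂⟩

/-- The naturality comparison of `p₂` is in `E` by (B), and triviality of `f` provides a retraction
of it; hence it is invertible. -/
lemma isTrivialCovering_snd {P A B D : C} {f : A ⟶ B} {g : D ⟶ B} {p₁ : P ⟶ A} {p₂ : P ⟶ D}
    (sq : IsPullback p₁ p₂ f g) (hf : Γ.IsTrivialCovering f) : Γ.IsTrivialCovering p₂ := by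
  have hp₂ : E p₂ := hΓ.extensionClass.snd sq hf.1
  obtain ⟨Q, q₁, q₂, k, sqQ, hk₁, hk₂, hk⟩ := hΓ.exists_unit_comparison hp₂
  have wD := toReflection_naturality (Γ := Γ) g
  obtain ⟨r, hr₁, hr₂⟩ := hf.isPullback.exists_lift (q₂ ≫ Γ.reflection.map p₁) (q₁ ≫ g) (by
    rw [Category.assoc, ← Functor.map_comp, sq.w, Functor.map_comp, ← reassoc_of% sqQ.w, wD]; simp)
  obtain ⟨ρ, hρ₁, hρ₂⟩ := sq.exists_lift r q₁ hr₂
  have hkρ : k ≫ ρ = 𝟙 P := by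
    apply sq.hom_ext
    · apply hf.isPullback.hom_ext
      · rw [Category.assoc, Category.assoc, reassoc_of% hρ₁, hr₁, reassoc_of% hk₂, Category.id_comp,
          toReflection_naturality]
      · rw [Category.assoc, Category.assoc, reassoc_of% hρ₁, hr₂, reassoc_of% hk₁, Category.id_comp,
        sq.w]
    · rw [Category.assoc, hρ₂, hk₁, Category.id_comp]
  exact ⟨hp₂, isPullback_of_isIso_comparison sqQ.flip (hΓ.isIso_of_retraction hk hkρ) hk₂ hk₁⟩

omit hΓ in
lemma isTrivialCovering_reflection_map {A B : C} {f : A ⟶ B} (hf : E f) :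
    Γ.IsTrivialCovering (Γ.reflection.map f) :=
  have := isIso_toReflection_reflection (Γ := Γ) A
  have := isIso_toReflection_reflection (Γ := Γ) B
  have sq : IsPullback (Γ.toReflection (Γ.reflection.obj A)) (Γ.reflection.map f)
      (Γ.reflection.map (Γ.reflection.map f)) (Γ.toReflection (Γ.reflection.obj B)) :=
    IsPullback.of_horiz_isIso ⟨toReflection_naturality _⟩
  ⟨reflection_map_mem hf, sq⟩

lemma isTrivialCovering_of_isPullback_reflection {A B P : C} {f : A ⟶ B} (hf : E f) {p₁ : P ⟶ B}
    {p₂ : P ⟶ Γ.reflection.obj A} (sq : IsPullback p₁ p₂ (Γ.toReflection B) (Γ.reflection.map f)) :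
    Γ.IsTrivialCovering p₁ :=
  hΓ.isTrivialCovering_snd sq.flip (isTrivialCovering_reflection_map hf)

/-- The reflector inverts units, so the image of `k` is a split monomorphism in `E`. -/
lemma isIso_reflection_map_comparison {A P : C} {k : A ⟶ P} {p₂ : P ⟶ Γ.reflection.obj A}
    (h₂ : k ≫ p₂ = Γ.toReflection A) (hk : E k) : IsIso (Γ.reflection.map k) := by
  have := isIso_reflection_map_toReflection (Γ := Γ) A
  refine hΓ.isIso_of_retraction
    (r := Γ.reflection.map p₂ ≫ inv (Γ.reflection.map (Γ.toReflection A))) (reflection_map_mem hk)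
    ?_
  rw [← Category.assoc, ← Functor.map_comp, h₂, IsIso.hom_inv_id]

omit hΓ in
/-- Trivial coverings are local with respect to the morphisms inverted by the reflector. -/
lemma existsUnique_lift_trivialCovering {A V V' Z : C} {z : Z ⟶ A} (hz : Γ.IsTrivialCovering z)
    {u : V ⟶ V'} (hu : IsIso (Γ.reflection.map u)) {v' : V' ⟶ A} {g : V ⟶ Z} (hg : g ≫ z = u ≫ v') :
    ∃! g' : V' ⟶ Z, u ≫ g' = g ∧ g' ≫ z = v' := by
  have wu := toReflection_naturality (Γ := Γ) u
  obtain ⟨g', hg₁, hg₂⟩ := hz.isPullback.exists_lift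
    (Γ.toReflection V' ≫ inv (Γ.reflection.map u) ≫ Γ.reflection.map g) v' (by
    rw [Category.assoc, Category.assoc, ← Functor.map_comp, hg, Functor.map_comp,
      IsIso.inv_hom_id_assoc, toReflection_naturality])
  refine ⟨g', ⟨?_, hg₂⟩, ?_⟩
  · apply hz.isPullback.hom_ext
    · rw [Category.assoc, hg₁, ← reassoc_of% wu, IsIso.hom_inv_id_assoc, toReflection_naturality]
    · rw [Category.assoc, hg₂, hg]
  · rintro g'' ⟨h₁, h₂⟩
    apply hz.isPullback.hom_ext
    · rw [hg₁, ← toReflection_naturality, ← h₁, Functor.map_comp, IsIso.inv_hom_id_assoc]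
    · rw [hg₂, h₂]

/-- The naturality cube of the unit at a split epimorphism of `Ext(C)`: its comparison morphism
to the limit of the remaining seven vertices is in `E`. -/
lemma cube_comparison_mem {X Y Z V : C} {u : X ⟶ Y} {v : Z ⟶ V} {p : X ⟶ Z} {q : Y ⟶ V}
    (hu : E u) (hv : E v) (w : p ≫ v = u ≫ q) {σ : Z ⟶ X} {τ : V ⟶ Y} (hσ : σ ≫ p = 𝟙 Z)
    (hτ : τ ≫ q = 𝟙 V) (hστ : σ ≫ u = v ≫ τ) {P : C} {a₁ : P ⟶ Y} {a₂ : P ⟶ Γ.reflection.obj X}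
    (sqP : IsPullback a₁ a₂ (Γ.toReflection Y) (Γ.reflection.map u)) {k : X ⟶ P} (hk₁ : k ≫ a₁ = u)
    (hk₂ : k ≫ a₂ = Γ.toReflection X) {Q : C} {b₁ : Q ⟶ V} {b₂ : Q ⟶ Γ.reflection.obj Z}
    (sqQ : IsPullback b₁ b₂ (Γ.toReflection V) (Γ.reflection.map v)) {l : Z ⟶ Q} (hl₁ : l ≫ b₁ = v)
    (hl₂ : l ≫ b₂ = Γ.toReflection Z) {m : P ⟶ Q} (hm₁ : m ≫ b₁ = a₁ ≫ q)
    (hm₂ : m ≫ b₂ = a₂ ≫ Γ.reflection.map p)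
    {L : C} {l₁ : L ⟶ P} {l₂ : L ⟶ Z} (sqL : IsPullback l₁ l₂ m l) {c : X ⟶ L}
    (hc₁ : c ≫ l₁ = k) (hc₂ : c ≫ l₂ = p) : E c := by
  have hk := hΓ.unit_comparison_mem hu sqP hk₁ hk₂
  have hl := hΓ.unit_comparison_mem hv sqQ hl₁ hl₂
  have nq := toReflection_naturality (Γ := Γ) q
  have nτ := toReflection_naturality (Γ := Γ) τ
  obtain ⟨n, hn₁, hn₂⟩ := sqP.exists_lift (b₁ ≫ τ) (b₂ ≫ Γ.reflection.map σ) (by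
    rw [Category.assoc, ← nτ, reassoc_of% sqQ.w, Category.assoc, ← Functor.map_comp,
      ← Functor.map_comp, hστ])
  -- By (B), `k` and `l` are objects of `Ext E`; the sections `σ` and `n` split `Φ`, so (E5)
  -- applies.
  let Φ : Ext.mk k hk ⟶ Ext.mk l hl := Ext.homMk hk hl p m (by
    apply sqQ.hom_ext
    · rw [Category.assoc, Category.assoc, hl₁, hm₁, reassoc_of% hk₁, w]
    · rw [Category.assoc, Category.assoc, hl₂, hm₂, reassoc_of% hk₂, toReflection_naturality])
  let Ψ : Ext.mk l hl ⟶ Ext.mk k hk := Ext.homMk hl hk σ n (by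
    apply sqP.hom_ext
    · rw [Category.assoc, Category.assoc, hk₁, hn₁, reassoc_of% hl₁, hστ]
    · rw [Category.assoc, Category.assoc, hk₂, hn₂, reassoc_of% hl₂, toReflection_naturality])
  have hnm : n ≫ m = 𝟙 Q := by
    apply sqQ.hom_ext
    · rw [Category.assoc, hm₁, reassoc_of% hn₁, hτ, Category.comp_id, Category.id_comp]
    · rw [Category.assoc, hm₂, reassoc_of% hn₂, ← Functor.map_comp, hσ,
      CategoryTheory.Functor.map_id,
        Category.comp_id, Category.id_comp]
  have hΦ : extClass E Φ := hΓ.e5 Φ ⟨⟨Ψ, Ext.hom_ext hσ hnm⟩⟩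
  exact hΦ.comparison hΓ.extensionClass sqL hc₁ hc₂

/-- The morphism `e` is a base change of the naturality comparison of `q`, followed by a base change
of the unit at `D`. -/
lemma comparison_reflection_pullback_mem {D' D A' A : C} {d : D ⟶ A} {q : A' ⟶ A} {p₁ : D' ⟶ D}
    {p₂ : D' ⟶ A'} (sq : IsPullback p₁ p₂ d q) (hq : E q) {Q : C}
    {w₁ : Q ⟶ Γ.reflection.obj D} {w₂ : Q ⟶ Γ.reflection.obj A'}
    (sqQ : IsPullback w₁ w₂ (Γ.reflection.map d) (Γ.reflection.map q))
    {e : D' ⟶ Q} (he₁ : e ≫ w₁ = p₁ ≫ Γ.toReflection D) (he₂ : e ≫ w₂ = p₂ ≫ Γ.toReflection A') :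
    E e := by
  have hE := hΓ.extensionClass
  obtain ⟨P, c₁, c₂, k, sqP, hk₁, hk₂, hk⟩ := hΓ.exists_unit_comparison hq
  obtain ⟨M, m, r, sqM⟩ := hE.exists_pullback (hE.fst sqP (reflection_map_mem hq)) d
  have nd := toReflection_naturality (Γ := Γ) d
  obtain ⟨n, hn₁, hn₂⟩ := sqQ.exists_lift (r ≫ Γ.toReflection D) (m ≫ c₂) (by
    rw [Category.assoc, nd, ← reassoc_of% sqM.w, Category.assoc, sqP.w])
  have sqn : IsPullback n r w₁ (Γ.toReflection D) := by
    refine IsPullback.of_right (h₁₂ := w₂) (v₁₃ := Γ.reflection.map q) (h₂₂ := Γ.reflection.map d)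
      ?_ hn₁ sqQ.flip
    rw [hn₂, nd]
    exact (sqM.flip.paste_vert sqP).flip
  obtain ⟨j, hj₁, hj₂⟩ := sqM.exists_lift (p₂ ≫ k) p₁ (by rw [Category.assoc, hk₁, sq.w])
  have sqj : IsPullback p₂ j k m := by
    refine IsPullback.of_bot (v₂₁ := r) (v₂₂ := c₁) (h₃₁ := d) ?_ hj₁.symm sqM
    rw [hj₂, hk₁]
    exact sq.flip
  refine hE.of_eq_comp (f := j) (g := n) ?_ (hE.snd sqj hk) (hE.fst sqn (hΓ.toReflection_mem D))
  apply sqQ.hom_ext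
  · rw [Category.assoc, hn₁, he₁, reassoc_of% hj₂]
  · rw [Category.assoc, hn₂, he₂, reassoc_of% hj₁, hk₂]

/-- the reflector preserves pullbacks of morphisms of `E` along split epimorphisms. -/
lemma isPullback_reflection_map {D' D A' A : C} {d : D ⟶ A} {q : A' ⟶ A} {p₁ : D' ⟶ D}
    {p₂ : D' ⟶ A'} (sq : IsPullback p₁ p₂ d q) (hd : E d) {s : A ⟶ A'} (hs : s ≫ q = 𝟙 A) :
    IsPullback (Γ.reflection.map p₁) (Γ.reflection.map p₂) (Γ.reflection.map d)
      (Γ.reflection.map q) := by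
  have hE := hΓ.extensionClass
  have hq : E q := hE.of_section hs
  have hp₁ : E p₁ := hE.fst sq hq
  have hp₂ : E p₂ := hE.snd sq hd
  obtain ⟨σ, hσ₁, hσ₂⟩ := sq.exists_lift (𝟙 D) (d ≫ s) (by
    rw [Category.id_comp, Category.assoc, hs, Category.comp_id])
  obtain ⟨P, a₁, a₂, k, sqP, hk₁, hk₂, hk⟩ := hΓ.exists_unit_comparison hp₂
  obtain ⟨R, b₁, b₂, l, sqR, hl₁, hl₂, hl⟩ := hΓ.exists_unit_comparison hd
  have nq := toReflection_naturality (Γ := Γ) q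
  obtain ⟨m, hm₁, hm₂⟩ := sqR.exists_lift (a₁ ≫ q) (a₂ ≫ Γ.reflection.map p₁) (by
    rw [Category.assoc, ← nq, reassoc_of% sqP.w, Category.assoc, ← Functor.map_comp,
      ← Functor.map_comp, sq.w])
  have hkm : k ≫ m = p₁ ≫ l := by
    apply sqR.hom_ext
    · rw [Category.assoc, Category.assoc, hm₁, hl₁, reassoc_of% hk₁, sq.w]
    · rw [Category.assoc, Category.assoc, hm₂, hl₂, reassoc_of% hk₂, toReflection_naturality]
  obtain ⟨L, l₂, l₁, sqL⟩ := hE.exists_pullback hl m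
  obtain ⟨c, hc₂, hc₁⟩ := sqL.exists_lift p₁ k hkm.symm
  have hc : E c := hΓ.cube_comparison_mem hp₂ hd sq.w hσ₁ hs hσ₂ sqP hk₁ hk₂ sqR hl₁ hl₂ hm₁ hm₂
    sqL.flip hc₁ hc₂
  -- Both projections of the pullback `D'` factor through `c`.
  have hcm : Mono c := ⟨fun x y hxy => sq.hom_ext (by rw [← hc₂, reassoc_of% hxy])
    (by rw [← hk₁, ← hc₁, Category.assoc, reassoc_of% hxy])⟩
  have hci : IsIso c := hΓ.isIso_of_mono hc hcm
  obtain ⟨Q, w₁, w₂, sqQ⟩ := hE.exists_pullback (reflection_map_mem hd) (Γ.reflection.map q)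
  obtain ⟨n, hn₁, hn₂⟩ := sqQ.exists_lift (Γ.reflection.map p₁) (Γ.reflection.map p₂) (by
    rw [← Functor.map_comp, ← Functor.map_comp, sq.w])
  obtain ⟨e, he⟩ : ∃ e : D' ⟶ Q, e = Γ.toReflection D' ≫ n := ⟨_, rfl⟩
  have he₁ : e ≫ w₁ = p₁ ≫ Γ.toReflection D := by
    rw [he, Category.assoc, hn₁, toReflection_naturality]
  have he₂ : e ≫ w₂ = p₂ ≫ Γ.toReflection A' := by
    rw [he, Category.assoc, hn₂, toReflection_naturality]
  have heE : E e := hΓ.comparison_reflection_pullback_mem sq hq sqQ he₁ he₂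
  have hn : E n := hE.of_comp_eq he.symm heE
  -- By (M), `n` is invertible as soon as its base change `n₁` along `e` is. Invertibility of `c`
  -- forces `n₂ = n₁ ≫ Γ.toReflection D'`, which makes the section `j` inverse to `n₁`.
  obtain ⟨N, n₂, n₁, sqN⟩ := hE.exists_pullback hn e
  obtain ⟨j, hj₂, hj₁⟩ := sqN.exists_lift (Γ.toReflection D') (𝟙 D') (by rw [Category.id_comp, he])
  obtain ⟨x, hx₁, hx₂⟩ := sqP.exists_lift (n₁ ≫ p₂) n₂ (by
    rw [Category.assoc, ← he₂, ← reassoc_of% sqN.w, hn₂])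
  obtain ⟨y, hy₂, hy₁⟩ := sqL.exists_lift (n₁ ≫ p₁) x (by
    apply sqR.hom_ext
    · rw [Category.assoc, Category.assoc, Category.assoc, hl₁, hm₁, reassoc_of% hx₁, sq.w]
    · rw [Category.assoc, Category.assoc, Category.assoc, hl₂, hm₂, reassoc_of% hx₂, ← he₁,
        ← reassoc_of% sqN.w, hn₁])
  have hz : y = n₁ ≫ c := by
    rw [← IsIso.comp_inv_eq]
    apply sq.hom_ext
    · rw [← hy₂, ← hc₂]; simp
    · rw [← hx₁, ← hy₁, Category.assoc y l₁, ← hk₁, ← hc₁]; simp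
  have hn₂₁ : n₂ = n₁ ≫ Γ.toReflection D' := by
    rw [← hx₂, ← hy₁, hz, Category.assoc, Category.assoc, reassoc_of% hc₁, hk₂]
  have hn₁i : IsIso n₁ := by
    refine ⟨j, ?_, hj₁⟩
    apply sqN.hom_ext
    · rw [Category.assoc, hj₂, ← hn₂₁, Category.id_comp]
    · rw [Category.assoc, hj₁, Category.id_comp, Category.comp_id]
  exact isPullback_of_isIso_comparison sqQ (hΓ.isIso_of_isPullback sqN hn heE hn₁i) hn₁ hn₂

/-- A split epimorphism that becomes a trivial covering when pulled back along a morphism of `E`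
is a trivial covering. -/
lemma isTrivialCovering_of_splitEpi {X' X Y W : C} {h : X ⟶ Y} {q : W ⟶ Y} {x : X' ⟶ X}
    {h' : X' ⟶ W} (sq : IsPullback x h' h q) (hq : E q) {s : Y ⟶ X} (hs : s ≫ h = 𝟙 Y)
    (hh' : Γ.IsTrivialCovering h') : Γ.IsTrivialCovering h := by
  have hE := hΓ.extensionClass
  have hh : E h := hE.of_section hs
  obtain ⟨T, t₁, t₂, k, sqT, hk₁, hk₂, hk⟩ := hΓ.exists_unit_comparison hh
  obtain ⟨T', y₁, y₂, sqT'⟩ := hE.exists_pullback (hE.fst sqT (reflection_map_mem hh)) q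
  obtain ⟨k', hk'₁, hk'₂⟩ := sqT'.exists_lift (x ≫ k) h' (by rw [Category.assoc, hk₁, sq.w])
  have sqk : IsPullback x k' k y₁ := by
    refine IsPullback.of_bot (v₂₁ := y₂) (v₂₂ := t₁) (h₃₁ := q) ?_ hk'₁.symm sqT'
    rw [hk'₂, hk₁]
    exact sq
  -- As the reflector preserves `sq`, both `X'` and `T'` are pullbacks of the same cospan. So `k'`
  -- is invertible, and its invertibility descends to `k`.
  have sq₁ := hh'.isPullback.paste_horiz (hΓ.isPullback_reflection_map sq.flip hq hs).flip
  have sq₂ := sqT'.flip.paste_vert sqT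
  rw [toReflection_naturality, toReflection_naturality] at sq₁
  have hk'i : IsIso k' := by
    refine isIso_of_isPullback_comparison sq₂.flip sq₁ ?_ hk'₂
    rw [reassoc_of% hk'₁, hk₂]
  exact ⟨hh, isPullback_of_isIso_comparison sqT.flip
    (hΓ.isIso_of_isPullback sqk hk (hE.fst sqT' hq) hk'i) hk₂ hk₁⟩

/-- Pulled back along `q`, the projection `π₂` becomes a kernel pair projection of the trivial
covering `h`. The diagonal splits `π₂`, so triviality descends. -/
lemma isTrivialCovering_kernelPair {A D K : C} {g : A ⟶ D} (hg : Γ.IsCovering g) {π₁ π₂ : K ⟶ A}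
    (sq : IsPullback π₁ π₂ g g) : Γ.IsTrivialCovering π₂ := by
  have hE := hΓ.extensionClass
  obtain ⟨hgE, T, p, ⟨hp, -⟩, P, q, h, sqP, hh⟩ := hg
  have hq : E q := hE.fst sqP hp
  obtain ⟨S, κ, h'', sqS⟩ := hE.exists_pullback (hE.snd sq hgE) q
  obtain ⟨m, hm₁, hm₂⟩ := sqP.exists_lift (κ ≫ π₁) (h'' ≫ h) (by
    rw [Category.assoc, sq.w, reassoc_of% sqS.w, sqP.w, Category.assoc])
  have sqm : IsPullback m h'' h h := by
    refine IsPullback.of_right (h₁₂ := q) (v₁₃ := g) (h₂₂ := p) ?_ hm₂ sqP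
    rw [hm₁, ← sqP.w]
    exact sqS.paste_horiz sq
  obtain ⟨δ, hδ₁, hδ₂⟩ := sq.exists_lift (𝟙 A) (𝟙 A) rfl
  exact hΓ.isTrivialCovering_of_splitEpi sqS hq hδ₂ (hΓ.isTrivialCovering_snd sqm hh)

/-- Every covering is a normal extension. -/
lemma isNormalExtension_of_isCovering {A D : C} {g : A ⟶ D} (hg : Γ.IsCovering g) :
    Γ.IsNormalExtension g := by
  obtain ⟨K, π₁, π₂, sq⟩ := hΓ.extensionClass.exists_pullback hg.1 g
  exact ⟨hΓ.m g hg.1, K, π₁, π₂, sq, hΓ.isTrivialCovering_kernelPair hg sq⟩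

lemma isCovering_of_isTrivialCovering {T B A P : C} {f : A ⟶ B} {p : T ⟶ B} {q : P ⟶ A}
    {h : P ⟶ T} (sq : IsPullback q h f p) (hf : E f) (hp : E p) (hh : Γ.IsTrivialCovering h) :
    Γ.IsCovering f :=
  ⟨hf, T, p, hΓ.m p hp, P, q, h, sq, hh⟩

/-- If a covering pulls back along `f ≫ β = α ≫ g`, where `g` is the covering, then the result is
a trivial covering. -/
lemma isTrivialCovering_of_isCovering {A A' D P : C} {α : A' ⟶ A} {g : A ⟶ D}
    (hg : Γ.IsCovering g) {p₁ : P ⟶ A} {p₂ : P ⟶ A'} {γ : A' ⟶ D} (hγ : α ≫ g = γ)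
    (sq : IsPullback p₁ p₂ g γ) : Γ.IsTrivialCovering p₂ := by
  subst hγ
  obtain ⟨K, π₁, π₂, sqK⟩ := hΓ.extensionClass.exists_pullback hg.1 g
  exact hΓ.isTrivialCovering_snd (IsPullback.of_right' sq sqK)
    (hΓ.isTrivialCovering_kernelPair hg sqK)

end Conditions

end GaloisStructure

section

variable {C : Type u} [Category.{v} C]

lemma isIso_of_isPullback_of_isIso {P P' A A' B D : C} {f : A ⟶ B} {f' : A' ⟶ B} {g : D ⟶ B}
    {p₁ : P ⟶ A} {p₂ : P ⟶ D} {p₁' : P' ⟶ A'} {p₂' : P' ⟶ D} (sq : IsPullback p₁ p₂ f g)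
    (sq' : IsPullback p₁' p₂' f' g) {a : A ⟶ A'} (ha : IsIso a) (hf : a ≫ f' = f) {k : P ⟶ P'}
    (h₁ : k ≫ p₁' = p₁ ≫ a) (h₂ : k ≫ p₂' = p₂) : IsIso k := by
  have sq'' : IsPullback (p₁ ≫ a) p₂ f' g :=
    sq.of_iso (Iso.refl _) (asIso a) (Iso.refl _) (Iso.refl _) (by simp) (by simp) (by simp [hf])
      (by simp)
  exact isIso_of_isPullback_comparison sq' sq'' h₁ h₂

end

/-! ### Reflecting extensions into coverings. -/

namespace GaloisStructure

variable {C : Type u} [Category.{v} C] {E : MorphismProperty C} {Γ : GaloisStructure E}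

/-- The morphism `r : A ⟶ A'` followed by `g : A' ⟶ B` is the reflection of `f : A ⟶ B` into the
coverings over `B`; the pullback of `g` along `f` is the reflection of the kernel pair projection
of `f` into the trivial coverings over `A`. -/
structure IsCoveringReflection (Γ : GaloisStructure E) {A A' B : C} (f : A ⟶ B) (r : A ⟶ A')
    (g : A' ⟶ B) : Prop where
  fac : r ≫ g = f
  isCovering : Γ.IsCovering g
  mem : E r
  exists_kernelPair_reflection : ∃ (R T : C) (π₁ π₂ : R ⟶ A) (t₁ : T ⟶ A)
    (t₂ : T ⟶ Γ.reflection.obj R) (c : T ⟶ A') (k : R ⟶ T), IsPullback π₁ π₂ f f ∧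
      IsPullback t₁ t₂ (Γ.toReflection A) (Γ.reflection.map π₂) ∧ IsPullback c t₁ g f ∧
      k ≫ t₁ = π₂ ∧ k ≫ t₂ = Γ.toReflection R ∧ k ≫ c = π₁ ≫ r ∧ E k
  existsUnique_lift : ∀ ⦃Z : C⦄ (z : Z ⟶ B) (h : A ⟶ Z), E z → h ≫ z = f → Γ.IsSplitBy z f →
    ∃! h' : A' ⟶ Z, r ≫ h' = h ∧ h' ≫ z = g

namespace Conditions

variable (hΓ : Γ.Conditions)
include hΓ

lemma isTrivialCovering_of_isPullback {P P' A B D : C} {f : A ⟶ B} {g : D ⟶ B} {p₁ : P ⟶ A}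
    {p₂ : P ⟶ D} {p₁' : P' ⟶ A} {p₂' : P' ⟶ D} (sq : IsPullback p₁ p₂ f g)
    (sq' : IsPullback p₁' p₂' f g) (h : Γ.IsTrivialCovering p₂) : Γ.IsTrivialCovering p₂' :=
  hΓ.isTrivialCovering_snd (g := 𝟙 D) (p₁ := (sq'.isoIsPullback _ _ sq).hom)
    (IsPullback.of_horiz_isIso ⟨by simp⟩) h

/-- The functor `A ×_B -` preserves morphisms over `A` inverted by the reflector. -/
lemma isIso_reflection_map_pullback_comp {A B U V U' V' : C} {f : A ⟶ B} (hf : E f)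
    {u : U ⟶ A} (hu : E u) {v : V ⟶ A} (hv : E v) {φ : U ⟶ V} (hφ : φ ≫ v = u)
    (hφi : IsIso (Γ.reflection.map φ)) {q : U' ⟶ U} {u' : U' ⟶ A} {r : V' ⟶ V} {v' : V' ⟶ A}
    (sqU : IsPullback q u' (u ≫ f) f) (sqV : IsPullback r v' (v ≫ f) f) {φ' : U' ⟶ V'}
    (h₁ : φ' ≫ r = q ≫ φ) (h₂ : φ' ≫ v' = u') : IsIso (Γ.reflection.map φ') := by
  obtain ⟨R, π₁, π₂, sq⟩ := hΓ.extensionClass.exists_pullback hf f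
  obtain ⟨δ, hδ₁, hδ₂⟩ := sq.exists_lift (𝟙 A) (𝟙 A) rfl
  obtain ⟨a, ha₁, ha₂⟩ := sq.exists_lift (q ≫ u) u' (by rw [Category.assoc, sqU.w])
  obtain ⟨b, hb₁, hb₂⟩ := sq.exists_lift (r ≫ v) v' (by rw [Category.assoc, sqV.w])
  -- Pulling `u ≫ f` back along `f` amounts to pulling `u` back along `π₁`, which is split by the
  -- diagonal; the reflector preserves such pullbacks.
  have sqa : IsPullback q a u π₁ := by
    refine (IsPullback.of_right (h₁₂ := π₂) (v₁₃ := f) (h₂₂ := f) ?_ ha₁ sq.flip).flip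
    rw [ha₂]
    exact sqU.flip
  have sqb : IsPullback r b v π₁ := by
    refine (IsPullback.of_right (h₁₂ := π₂) (v₁₃ := f) (h₂₂ := f) ?_ hb₁ sq.flip).flip
    rw [hb₂]
    exact sqV.flip
  refine isIso_of_isPullback_of_isIso (hΓ.isPullback_reflection_map sqa hu hδ₁)
    (hΓ.isPullback_reflection_map sqb hv hδ₁) hφi ?_ ?_ ?_
  · rw [← Functor.map_comp, hφ]
  · rw [← Functor.map_comp, h₁, Functor.map_comp]
  · rw [← Functor.map_comp]
    congr 1
    apply sq.hom_ext
    · rw [Category.assoc, hb₁, ha₁, reassoc_of% h₁, hφ]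
    · rw [Category.assoc, hb₂, ha₂, h₂]

/-- The left adjoint supplied by monadicity agrees with composition with `f` up to isomorphism,
which reduces the claim to the previous lemma. -/
lemma isIso_reflection_map_pullbackFunctor {A B : C} {f : A ⟶ B} (hf : E f)
    [MonadicRightAdjoint (hΓ.extensionClass.pullbackFunctor f)] {U V : E.Over ⊤ A} (φ : U ⟶ V)
    (hφ : IsIso (Γ.reflection.map φ.left)) :
    IsIso (Γ.reflection.map ((hΓ.extensionClass.pullbackFunctor f).map
      ((monadicLeftAdjoint (hΓ.extensionClass.pullbackFunctor f)).map φ)).left) := by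
  have hE := hΓ.extensionClass
  have := hE.hasPullbacks
  have := hE.stable
  have : E.IsStableUnderComposition := ⟨fun _ _ hf hg => hE.comp hf hg⟩
  let R := hE.pullbackFunctor f
  let O : E.Over ⊤ A ⥤ E.Over ⊤ B := MorphismProperty.Over.map ⊤ hf
  let adj : O ⊣ R := MorphismProperty.Over.mapPullbackAdj E ⊤ f hf trivial
  let θ := (monadicAdjunction R).leftAdjointUniq adj
  have hnat : R.map ((monadicLeftAdjoint R).map φ) =
      R.map (θ.hom.app U) ≫ R.map (O.map φ) ≫ R.map (θ.inv.app V) := by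
    rw [← Functor.map_comp, ← Functor.map_comp, ← θ.hom.naturality_assoc]
    simp
  have h₁ : IsIso (Γ.reflection.map (R.map (O.map φ)).left) :=
    hΓ.isIso_reflection_map_pullback_comp hf U.prop V.prop (over_w φ) hφ
      (hE.isPullback_pullbackFunctor f (O.obj U)) (hE.isPullback_pullbackFunctor f (O.obj V))
      (hE.pullbackFunctor_map_fst f (O.map φ)) (over_w (R.map (O.map φ)))
  have h₂ : IsIso (R.map (θ.hom.app U)).left := over_isIso_left _ inferInstance
  have h₃ : IsIso (R.map (θ.inv.app V)).left := over_isIso_left _ inferInstance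
  have h₄ : (R.map ((monadicLeftAdjoint R).map φ)).left =
      (R.map (θ.hom.app U)).left ≫ (R.map (O.map φ)).left ≫ (R.map (θ.inv.app V)).left :=
    congrArg (fun k => k.left) hnat
  change IsIso (Γ.reflection.map (R.map ((monadicLeftAdjoint R).map φ)).left)
  rw [h₄, Functor.map_comp, Functor.map_comp]
  infer_instance

lemma exists_isCoveringReflection {A B : C} {f : A ⟶ B} (hf : E f) :
    ∃ (A' : C) (r : A ⟶ A') (g : A' ⟶ B), Γ.IsCoveringReflection f r g := by
  have hE := hΓ.extensionClass
  obtain ⟨hM⟩ : Nonempty (MonadicRightAdjoint (hE.pullbackFunctor f)) := (hΓ.m f hf).2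
  let R := hE.pullbackFunctor f
  let X : E.Over ⊤ B := MorphismProperty.Over.mk ⊤ f hf
  have sqX := hE.isPullback_pullbackFunctor f X
  obtain ⟨T, t₁, t₂, k, sqT, hk₁, hk₂, hk⟩ := hΓ.exists_unit_comparison
    (f := ((R.obj X).hom : (R.obj X).left ⟶ A)) (R.obj X).prop
  have ht₁ : Γ.IsTrivialCovering t₁ := hΓ.isTrivialCovering_of_isPullback_reflection
    (f := ((R.obj X).hom : (R.obj X).left ⟶ A)) (R.obj X).prop sqT
  let Y : E.Over ⊤ A := MorphismProperty.Over.mk ⊤ t₁ ht₁.1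
  let κ : R.obj X ⟶ Y := MorphismProperty.Over.homMk k hk₁
  let S : ObjectProperty (E.Over ⊤ A) := fun Z => Γ.IsTrivialCovering (Z.hom : Z.left ⟶ A)
  let W : MorphismProperty (E.Over ⊤ A) := fun _ _ φ => IsIso (Γ.reflection.map φ.left)
  obtain ⟨Y', r, i, hi, hu⟩ := exists_reflection_of_monadic R W S
    (by
      intro U V Z φ hφ hZ g
      obtain ⟨g', ⟨h₁, h₂⟩, hg'⟩ :=
        existsUnique_lift_trivialCovering hZ hφ ((over_w g).trans (over_w φ).symm)
      refine ⟨MorphismProperty.Over.homMk g' h₂, by ext; exact h₁, fun l hl => ?_⟩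
      ext
      exact hg' l.left ⟨congrArg (fun k => k.left) hl, over_w l⟩)
    (fun U V φ hφ => hΓ.isIso_reflection_map_pullbackFunctor hf φ hφ) κ
    (hΓ.isIso_reflection_map_comparison hk₂ hk) ht₁
  have hil : IsIso i.inv.left := over_isIso_left _ inferInstance
  have hc : k ≫ i.inv.left ≫ hE.pullbackFst f Y' = hE.pullbackFst f X ≫ r.left := by
    have h₁ : κ ≫ i.inv = R.map r := by rw [← hi]; simp
    have h₂ : k ≫ i.inv.left = (R.map r).left := congrArg (fun k => k.left) h₁
    rw [← hE.pullbackFunctor_map_fst]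
    exact (Category.assoc _ _ _).symm.trans (congrArg (· ≫ hE.pullbackFst f Y') h₂)
  have sqc : IsPullback (i.inv.left ≫ hE.pullbackFst f Y') t₁ (Y'.hom : Y'.left ⟶ B) f :=
    isPullback_of_isIso_comparison (hE.isPullback_pullbackFunctor f Y') hil rfl (over_w i.inv)
  refine ⟨Y'.left, r.left, Y'.hom, over_w r, ?_, ?_, ?_, ?_⟩
  · exact hΓ.isCovering_of_isTrivialCovering sqc Y'.prop hf ht₁
  -- (E4) applied to the equality between `r` preceded by a kernel pair projection and a composite
  -- of two morphisms of `E`.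
  · exact hE.of_comp_eq hc.symm (hE.comp hk (hE.fst sqc hf))
  · exact ⟨_, T, _, _, t₁, t₂, _, k, sqX, sqT, sqc, hk₁, hk₂, hc, hk⟩
  · intro Z z h hz hhz hs
    obtain ⟨P, p₁, p₂, sqP, hp⟩ := hs
    let Zo : E.Over ⊤ B := MorphismProperty.Over.mk ⊤ z hz
    have hZ : S (R.obj Zo) :=
      hΓ.isTrivialCovering_of_isPullback sqP (hE.isPullback_pullbackFunctor f Zo) hp
    obtain ⟨h', hh', hh'u⟩ := hu (Z := Zo) (MorphismProperty.Over.homMk h hhz) hZ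
    refine ⟨h'.left, ⟨congrArg (fun k => k.left) hh', over_w h'⟩, fun l hl => ?_⟩
    exact congrArg (fun k => k.left) (hh'u (MorphismProperty.Over.homMk l hl.2)
      (by ext; exact hl.1))

/-- `ρ` is a base change of the comparison of `φ` followed by a base change of `φ.hom.left`. -/
lemma kernelPair_map_mem {a b : Ext E} {φ : a ⟶ b} (hφ : extClass E φ) {R R' : C}
    {π₁ π₂ : R ⟶ a.obj.left} {π₁' π₂' : R' ⟶ b.obj.left}
    (sq : IsPullback π₁ π₂ a.obj.hom a.obj.hom) (sq' : IsPullback π₁' π₂' b.obj.hom b.obj.hom)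
    {ρ : R ⟶ R'} (hρ₁ : ρ ≫ π₁' = π₁ ≫ φ.hom.left) (hρ₂ : ρ ≫ π₂' = π₂ ≫ φ.hom.left) : E ρ := by
  have hE := hΓ.extensionClass
  obtain ⟨hl, hr, Q, q₁, q₂, k, sqQ, hk₁, hk₂, hk⟩ := hφ
  have wφ := Ext.w φ
  obtain ⟨M, mq, ma, sqM⟩ := hE.exists_pullback (hE.fst sqQ b.property) a.obj.hom
  obtain ⟨j, hj₁, hj₂⟩ := sqM.exists_lift (π₁ ≫ k) π₂ (by rw [Category.assoc, hk₁, sq.w])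
  obtain ⟨n, hn₁, hn₂⟩ := sq'.exists_lift (mq ≫ q₂) (ma ≫ φ.hom.left) (by
    rw [Category.assoc, ← sqQ.w, reassoc_of% sqM.w, Category.assoc, wφ])
  have sqj : IsPullback π₁ j k mq := by
    refine IsPullback.of_bot (v₂₁ := ma) (v₂₂ := q₁) (h₃₁ := a.obj.hom) ?_ hj₁.symm sqM
    rw [hj₂, hk₁]
    exact sq
  have sqn : IsPullback n ma π₂' φ.hom.left := by
    refine IsPullback.of_right (h₁₂ := π₁') (v₁₃ := b.obj.hom) (h₂₂ := b.obj.hom) ?_ hn₂ sq'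
    rw [hn₁, wφ]
    exact sqM.paste_horiz sqQ.flip
  refine hE.of_eq_comp (f := j) (g := n) ?_ (hE.snd sqj hk) (hE.fst sqn hl)
  apply sq'.hom_ext
  · rw [Category.assoc, hn₁, hρ₁, reassoc_of% hj₁, hk₂]
  · rw [Category.assoc, hn₂, hρ₂, reassoc_of% hj₂]

/-- The naturality square of the reflection into coverings at a morphism of `extClass E` has its
comparison morphism in `E`. -/
lemma coveringReflection_comparison_mem {a b : Ext E} {φ : a ⟶ b} (hφ : extClass E φ) {A' B' : C}
    {r : a.obj.left ⟶ A'} {a' : A' ⟶ a.obj.right} (ha : Γ.IsCoveringReflection a.obj.hom r a')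
    {s : b.obj.left ⟶ B'} {b' : B' ⟶ b.obj.right} (hb : Γ.IsCoveringReflection b.obj.hom s b')
    {θ : A' ⟶ B'} (hθ₁ : r ≫ θ = φ.hom.left ≫ s) (hθ₂ : θ ≫ b' = a' ≫ φ.hom.right) {K : C}
    {p₁ : K ⟶ b.obj.left} {p₂ : K ⟶ A'} (sqK : IsPullback p₁ p₂ s θ) {κ : a.obj.left ⟶ K}
    (hκ₁ : κ ≫ p₁ = φ.hom.left) (hκ₂ : κ ≫ p₂ = r) : E κ := by
  have hE := hΓ.extensionClass
  have wφ := Ext.w φ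
  obtain ⟨R, T, π₁, π₂, t₁, t₂, c, k, sqR, sqT, sqc, hk₁, hk₂, hkc, hk⟩ :=
    ha.exists_kernelPair_reflection
  obtain ⟨R', T', π₁', π₂', t₁', t₂', c', k', sqR', sqT', sqc', hk₁', hk₂', hkc', hk'⟩ :=
    hb.exists_kernelPair_reflection
  obtain ⟨ρ, hρ₁, hρ₂⟩ := sqR'.exists_lift (π₁ ≫ φ.hom.left) (π₂ ≫ φ.hom.left) (by
    rw [Category.assoc, Category.assoc, wφ, reassoc_of% sqR.w])
  have hρ : E ρ := hΓ.kernelPair_map_mem hφ sqR sqR' hρ₁ hρ₂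
  have nφ := toReflection_naturality (Γ := Γ) φ.hom.left
  obtain ⟨τ, hτ₁, hτ₂⟩ := sqT'.exists_lift (t₁ ≫ φ.hom.left) (t₂ ≫ Γ.reflection.map ρ) (by
    rw [Category.assoc, ← nφ, reassoc_of% sqT.w, Category.assoc, ← Functor.map_comp,
      ← Functor.map_comp, hρ₂])
  obtain ⟨τ', hτ'₂, hτ'₁⟩ := sqc'.exists_lift (c ≫ θ) (t₁ ≫ φ.hom.left) (by
    rw [Category.assoc, hθ₂, reassoc_of% sqc.w, Category.assoc, wφ])
  have hπ₂' : E π₂' := hE.snd sqR' b.property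
  have hτc : τ ≫ c' = c ≫ θ := by
    have hki := hΓ.isIso_reflection_map_comparison hk₂ hk
    -- Both are diagonals from `k`, inverted by the reflector, to the trivial covering `t₁'`, and
    -- such diagonals are unique.
    have : τ = τ' := by
      refine (existsUnique_lift_trivialCovering (g := ρ ≫ k') (v' := t₁ ≫ φ.hom.left)
        (hΓ.isTrivialCovering_of_isPullback_reflection hπ₂' sqT') hki ?_).unique
        ⟨?_, hτ₁⟩ ⟨?_, hτ'₁⟩
      · rw [Category.assoc, hk₁', hρ₂, reassoc_of% hk₁]
      · apply sqT'.hom_ext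
        · rw [Category.assoc, Category.assoc, hτ₁, hk₁', hρ₂, reassoc_of% hk₁]
        · rw [Category.assoc, Category.assoc, hτ₂, hk₂', reassoc_of% hk₂, toReflection_naturality]
      · apply sqc'.hom_ext
        · rw [Category.assoc, Category.assoc, hτ'₂, hkc', reassoc_of% hkc, hθ₁, reassoc_of% hρ₁]
        · rw [Category.assoc, Category.assoc, hτ'₁, hk₁', hρ₂, reassoc_of% hk₁]
    rw [this, hτ'₂]
  have hc : E c := hE.fst sqc a.property
  obtain ⟨L, y₁, y₂, sqL⟩ := hE.exists_pullback hc p₂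
  obtain ⟨d, hd₁, hd₂⟩ := sqL.exists_lift k (π₁ ≫ κ) (by rw [Category.assoc, hκ₂, hkc])
  -- By (E4), `κ` may be tested after composition with `π₁`, where it factors through `d`.
  suffices hdE : E d from hE.of_comp_eq hd₂.symm (hE.comp hdE (hE.snd sqL hc))
  obtain ⟨n, hn₁, hn₂⟩ := sqR'.exists_lift (y₂ ≫ p₁) (y₁ ≫ t₁ ≫ φ.hom.left) (by
    rw [Category.assoc, Category.assoc, Category.assoc, wφ, ← hb.fac, reassoc_of% sqK.w, hθ₂,
      ← reassoc_of% sqL.w, reassoc_of% sqc.w])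
  have hnk : n ≫ k' = y₁ ≫ τ := by
    apply sqc'.hom_ext
    · rw [Category.assoc, Category.assoc, hkc', hτc, reassoc_of% hn₁, sqK.w, reassoc_of% sqL.w]
    · rw [Category.assoc, Category.assoc, hk₁', hτ₁, hn₂]
  obtain ⟨P, a₁, a₂, l, sqP, hl₁, hl₂, hl⟩ := hΓ.exists_unit_comparison hρ
  obtain ⟨Q, b₁, b₂, l', sqQ, hl₁', hl₂', hl'⟩ := hΓ.exists_unit_comparison hφ.1
  have nπ := toReflection_naturality (Γ := Γ) π₂'
  obtain ⟨m, hm₁, hm₂⟩ := sqQ.exists_lift (a₁ ≫ π₂') (a₂ ≫ Γ.reflection.map π₂) (by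
    rw [Category.assoc, ← nπ, reassoc_of% sqP.w, Category.assoc, ← Functor.map_comp,
      ← Functor.map_comp, hρ₂])
  obtain ⟨l₁, hla₁, hla₂⟩ := sqP.exists_lift n (y₁ ≫ t₂) (by
    rw [← hk₂', reassoc_of% hnk, hτ₂, Category.assoc])
  -- This identifies `L` with the limit of the naturality cube of the unit at `(π₂, π₂') : ρ ⟶
  -- φ.hom.left` without its initial vertex. Diagonals split that square, so `d` is its cube
  -- comparison.
  have sq : IsPullback l₁ (y₁ ≫ t₁) m l' := by
    refine IsPullback.mk' ?_ ?_ ?_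
    · apply sqQ.hom_ext
      · rw [Category.assoc, Category.assoc, Category.assoc, hm₁, hl₁', reassoc_of% hla₁, hn₂]
      · rw [Category.assoc, Category.assoc, Category.assoc, hm₂, hl₂', reassoc_of% hla₂, sqT.w]
    · intro V x y h₁ h₂
      have h₃ : x ≫ y₁ = y ≫ y₁ := by
        apply sqT.hom_ext
        · rw [Category.assoc, Category.assoc, h₂]
        · rw [Category.assoc, Category.assoc, ← hla₂, reassoc_of% h₁]
      apply sqL.hom_ext h₃
      apply sqK.hom_ext
      · rw [Category.assoc, Category.assoc, ← hn₁, ← hla₁, Category.assoc, reassoc_of% h₁]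
      · rw [Category.assoc, Category.assoc, ← sqL.w, reassoc_of% h₃]
    · intro V x z h
      obtain ⟨e, he₁, he₂⟩ := sqT.exists_lift z (x ≫ a₂) (by
        rw [Category.assoc, ← hm₂, reassoc_of% h, hl₂'])
      have hek : x ≫ a₁ ≫ k' = e ≫ τ := by
        apply sqT'.hom_ext
        · rw [Category.assoc, Category.assoc, Category.assoc, hk₁', hτ₁, ← hm₁, reassoc_of% h,
            hl₁', reassoc_of% he₁]
        · rw [Category.assoc, Category.assoc, Category.assoc, hk₂', hτ₂, sqP.w, reassoc_of% he₂]
      obtain ⟨f, hf₁, hf₂⟩ := sqK.exists_lift (x ≫ a₁ ≫ π₁') (e ≫ c) (by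
        rw [Category.assoc, Category.assoc, ← hkc', Category.assoc, ← hτc, ← reassoc_of% hek])
      obtain ⟨g, hg₁, hg₂⟩ := sqL.exists_lift e f hf₂.symm
      refine ⟨g, sqP.hom_ext (sqR'.hom_ext ?_ ?_) ?_, ?_⟩
      · simp only [Category.assoc]
        rw [reassoc_of% hla₁, hn₁, reassoc_of% hg₂, hf₁]
      · simp only [Category.assoc]
        rw [reassoc_of% hla₁, hn₂, reassoc_of% hg₁, reassoc_of% he₁, ← hm₁, reassoc_of% h, hl₁']
      · rw [Category.assoc, hla₂, reassoc_of% hg₁, he₂]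
      · rw [reassoc_of% hg₁, he₁]
  obtain ⟨δ, hδ₁, hδ₂⟩ := sqR.exists_lift (𝟙 _) (𝟙 _) rfl
  obtain ⟨δ', hδ₁', hδ₂'⟩ := sqR'.exists_lift (𝟙 _) (𝟙 _) rfl
  refine hΓ.cube_comparison_mem hρ hφ.1 hρ₂.symm hδ₂ hδ₂' ?_ sqP hl₁ hl₂ sqQ hl₁' hl₂' hm₁ hm₂ sq
    ?_ ?_
  · apply sqR'.hom_ext
    · rw [Category.assoc, Category.assoc, hρ₁, hδ₁', reassoc_of% hδ₁, Category.comp_id]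
    · rw [Category.assoc, Category.assoc, hρ₂, hδ₂', reassoc_of% hδ₂, Category.comp_id]
  · apply sqP.hom_ext
    · rw [Category.assoc, hla₁, hl₁]
      apply sqR'.hom_ext
      · rw [Category.assoc, hn₁, reassoc_of% hd₂, hκ₁, hρ₁]
      · rw [Category.assoc, hn₂, reassoc_of% hd₁, reassoc_of% hk₁, hρ₂]
    · rw [Category.assoc, hla₂, reassoc_of% hd₁, hk₂, hl₂]
  · rw [reassoc_of% hd₁, hk₁]

end Conditions

end GaloisStructure

/-! ### Assembling the Galois structure on `Ext E`. -/

lemma exists_adjunction_ι_of_existsUnique {D : Type u} [Category.{v} D] (P : ObjectProperty D)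
    (Q : MorphismProperty D)
    (h : ∀ d : D, ∃ (r : P.FullSubcategory) (η : d ⟶ r.obj), Q η ∧
      ∀ (y : P.FullSubcategory) (f : d ⟶ y.obj), ∃! g : r.obj ⟶ y.obj, η ≫ g = f) :
    ∃ (I : D ⥤ P.FullSubcategory) (adj : I ⊣ P.ι), ∀ d, Q (adj.unit.app d) := by
  choose r η hQ hu using h
  choose l hl hl' using hu
  let e (d : D) (y : P.FullSubcategory) : (r d ⟶ y) ≃ (d ⟶ P.ι.obj y) :=
    { toFun := fun g => η d ≫ g.hom
      invFun := fun f => ObjectProperty.homMk (l d y f)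
      left_inv := fun g => InducedCategory.hom_ext (hl' d y _ _ rfl).symm
      right_inv := fun f => hl d y f }
  have he : ∀ d y y' (g : y ⟶ y') (k : r d ⟶ y), e d y' (k ≫ g) = e d y k ≫ P.ι.map g :=
    fun d y y' g k => (Category.assoc _ _ _).symm
  refine ⟨Adjunction.leftAdjointOfEquiv e he, Adjunction.adjunctionOfEquivLeft e he, fun d => ?_⟩
  have : (Adjunction.adjunctionOfEquivLeft e he).unit.app d = η d := Category.comp_id _
  rw [this]
  exact hQ d

variable {C : Type u} [Category.{v} C] {E : MorphismProperty C}

lemma extClass_of_isIso_right (hE : ExtensionClass E) {a b : Ext E} {φ : a ⟶ b}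
    (hl : E φ.hom.left) (hr : IsIso φ.hom.right) : extClass E φ := by
  refine extClass.exists_comparison hE hl (hE.e1 _ hr) fun P p₁ p₂ k sq h₁ h₂ => ?_
  have : IsIso p₂ := sq.isIso_snd_of_isIso
  rw [← IsIso.eq_comp_inv] at h₂
  rw [h₂]
  exact hE.comp hl (hE.e1 _ inferInstance)

namespace GaloisStructure

variable {Γ : GaloisStructure E}

/-- A morphism from an extension to its reflection into the coverings. -/
def IsCoveringUnit (Γ : GaloisStructure E) : MorphismProperty (Ext E) := fun a b φ =>
  IsIso φ.hom.right ∧ ∃ g : b.obj.left ⟶ a.obj.right,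
    Γ.IsCoveringReflection a.obj.hom φ.hom.left g ∧ g ≫ φ.hom.right = b.obj.hom

namespace Conditions

variable (hΓ : Γ.Conditions)
include hΓ

lemma isClosedUnderIsomorphisms_coverings : Γ.coverings.IsClosedUnderIsomorphisms where
  of_iso {a b} i h := by
    obtain ⟨-, T, p, hp, P, q, k, sq, hk⟩ := h
    have hl : IsIso i.hom.hom.left := Ext.isIso_left i.hom inferInstance
    have hr : IsIso i.hom.hom.right := Ext.isIso_right i.hom inferInstance
    have hE := hΓ.extensionClass
    refine hΓ.isCovering_of_isTrivialCovering (p := p ≫ i.hom.hom.right)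
      (q := q ≫ i.hom.hom.left) (h := k) ?_ b.property (hE.comp hp.1 (hE.e1 _ hr)) hk
    exact sq.of_iso (Iso.refl _) (asIso i.hom.hom.left) (Iso.refl _) (asIso i.hom.hom.right)
      (by simp) (by simp) (Ext.w i.hom).symm (by simp)

lemma exists_isCoveringUnit (a : Ext E) :
    ∃ (r : Γ.coverings.FullSubcategory) (η : a ⟶ r.obj), Γ.IsCoveringUnit η ∧
      ∀ (y : Γ.coverings.FullSubcategory) (f : a ⟶ y.obj), ∃! g : r.obj ⟶ y.obj, η ≫ g = f := by
  have hE := hΓ.extensionClass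
  obtain ⟨A', r, g, h⟩ := hΓ.exists_isCoveringReflection a.property
  let η : a ⟶ Ext.mk g h.isCovering.1 :=
    ObjectProperty.homMk (Arrow.homMk r (𝟙 _) (h.fac.trans (Category.comp_id _).symm))
  refine ⟨⟨Ext.mk g h.isCovering.1, h.isCovering⟩, η,
    ⟨(inferInstance : IsIso (𝟙 _)), g, h, Category.comp_id _⟩, fun y φ => ?_⟩
  have hy : Γ.IsCovering y.obj.obj.hom := y.property
  -- A morphism to a covering with another codomain is one over `a.obj.right` to the pulled back
  -- covering. The latter is split by `a.obj.hom`, since `a.obj.hom ≫ φ.hom.right` factors through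
  -- `y`.
  obtain ⟨P, p₁, p₂, sq⟩ := hE.exists_pullback hy.1 φ.hom.right
  obtain ⟨l, hl₁, hl₂⟩ := sq.exists_lift φ.hom.left a.obj.hom (Ext.w φ)
  obtain ⟨K, k₁, k₂, sqK⟩ := hE.exists_pullback (hE.snd sq hy.1) a.obj.hom
  obtain ⟨h', ⟨hh₁, hh₂⟩, hu⟩ := h.existsUnique_lift p₂ l (hE.snd sq hy.1) hl₂
    ⟨K, k₁, k₂, sqK, hΓ.isTrivialCovering_of_isCovering hy (Ext.w φ)
      (sqK.flip.paste_vert sq.flip).flip⟩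
  refine ⟨ObjectProperty.homMk (Arrow.homMk (h' ≫ p₁) φ.hom.right ?_), ?_, fun ψ hψ => ?_⟩
  · change (h' ≫ p₁) ≫ y.obj.obj.hom = g ≫ φ.hom.right
    rw [Category.assoc, sq.w, reassoc_of% hh₂]
  · ext
    · change r ≫ h' ≫ p₁ = φ.hom.left
      rw [reassoc_of% hh₁, hl₁]
    · exact Category.id_comp _
  · have hψl : r ≫ ψ.hom.left = φ.hom.left := Ext.congr_left hψ
    have hψr : ψ.hom.right = φ.hom.right :=
      (Category.id_comp _).symm.trans (Ext.congr_right hψ)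
    have wψ : ψ.hom.left ≫ y.obj.obj.hom = g ≫ φ.hom.right :=
      (Ext.w ψ).trans (congrArg (g ≫ ·) hψr)
    obtain ⟨m, hm₁, hm₂⟩ := sq.exists_lift ψ.hom.left g wψ
    have : m = h' := by
      refine hu m ⟨?_, hm₂⟩
      apply sq.hom_ext
      · rw [Category.assoc, hm₁, hψl, hl₁]
      · rw [Category.assoc, hm₂, hl₂, h.fac]
    ext
    · change ψ.hom.left = h' ≫ p₁
      rw [← this, hm₁]
    · exact hψr

lemma extClass_of_isCoveringUnit {a b : Ext E} {φ : a ⟶ b} (hφ : Γ.IsCoveringUnit φ) :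
    extClass E φ := by
  obtain ⟨hr, g, h, -⟩ := hφ
  exact extClass_of_isIso_right hΓ.extensionClass h.mem hr

/-- On codomains the units are invertible, hence so is the comparison; only the domain component
carries content. -/
lemma isCoveringUnit_comparison_mem {a b a' b' p : Ext E} {φ : a ⟶ b} (hφ : extClass E φ)
    {η : a ⟶ a'} (hη : Γ.IsCoveringUnit η) {ε : b ⟶ b'} (hε : Γ.IsCoveringUnit ε) {ψ : a' ⟶ b'}
    (w : η ≫ ψ = φ ≫ ε) {p₁ : p ⟶ b} {p₂ : p ⟶ a'} (sq : IsPullback p₁ p₂ ε ψ) {k : a ⟶ p}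
    (h₁ : k ≫ p₁ = φ) (h₂ : k ≫ p₂ = η) : extClass E k := by
  have hE := hΓ.extensionClass
  obtain ⟨sql, sqr, -⟩ := extClass.isPullback_levelwise hE sq (hΓ.extClass_of_isCoveringUnit hε)
  obtain ⟨hηr, g, hg, hgη⟩ := hη
  obtain ⟨hεr, d, hd, hdε⟩ := hε
  have wl : η.hom.left ≫ ψ.hom.left = φ.hom.left ≫ ε.hom.left := Ext.congr_left w
  have wr : η.hom.right ≫ ψ.hom.right = φ.hom.right ≫ ε.hom.right := Ext.congr_right w
  have hp₂ : IsIso p₂.hom.right := sqr.isIso_snd_of_isIso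
  have hkr : IsIso k.hom.right := by
    have h : k.hom.right ≫ p₂.hom.right = η.hom.right := Ext.congr_right h₂
    rw [← IsIso.eq_comp_inv] at h
    rw [h]
    infer_instance
  refine extClass_of_isIso_right hE ?_ hkr
  refine hΓ.coveringReflection_comparison_mem hφ hg hd wl ?_ sql (Ext.congr_left h₁)
    (Ext.congr_left h₂)
  rw [← cancel_mono ε.hom.right, Category.assoc, hdε, Category.assoc, ← wr, reassoc_of% hgη, Ext.w]

/-- The Galois structure on `Ext E` whose reflective subcategory consists of the coverings. -/
theorem exists_galoisStructure_extClass :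
    ∃ Γ₁ : GaloisStructure (extClass E), Γ₁.X = Γ.coverings ∧ Γ₁.Conditions := by
  have hE := hΓ.extensionClass
  obtain ⟨I, adj, hadj⟩ :=
    exists_adjunction_ι_of_existsUnique Γ.coverings Γ.IsCoveringUnit hΓ.exists_isCoveringUnit
  have hη : ∀ a, extClass E (adj.unit.app a) := fun a => hΓ.extClass_of_isCoveringUnit (hadj a)
  let Γ₁ : GaloisStructure (extClass E) :=
    { X := Γ.coverings
      replete := hΓ.isClosedUnderIsomorphisms_coverings
      I := I
      adj := adj
      e1 := hE.extClass.e1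
      e2_exists := hE.extClass.hasPullbacks
      e2_stable := hE.extClass.stable
      e3 := fun _ _ _ _ _ => extClass.comp hE
      -- (G) follows from (E4), since the unit at `a` followed by the reflection of `φ` is `φ`
      -- followed by the unit at `b`.
      g := fun a b φ hφ =>
        hE.extClass.of_comp_eq (adj.unit.naturality φ).symm (extClass.comp hE hφ (hη b)) }
  refine ⟨Γ₁, rfl, hE.extClass.e4, hE.extClass.e5, fun T B p hp => ⟨hp, ?_⟩, fun a b φ hφ => ?_⟩
  · exact monadic_pullbackFunctor_ext hE (fun T B p hp => (hΓ.m p hp).2) p hp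
  · refine extClass.exists_comparison hE.extClass (hη a) (hη b) fun P p₁ p₂ k sq h₁ h₂ => ?_
    exact hΓ.isCoveringUnit_comparison_mem hφ (hadj a) (hadj b) (adj.unit.naturality φ).symm sq
      h₁ h₂

end Conditions

/-! ### The iterated chain. -/

/-- The chain of Galois structures obtained by iterating the passage to coverings. -/
noncomputable def chain (Γ : GaloisStructure E) (hΓ : Γ.Conditions) :
    ∀ n : ℕ, { Γ' : GaloisStructure (iterExt E n).E // Γ'.Conditions }
  | 0 => ⟨hΓ.exists_galoisStructure_extClass.choose,
      hΓ.exists_galoisStructure_extClass.choose_spec.2⟩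
  | n + 1 => ⟨(chain Γ hΓ n).2.exists_galoisStructure_extClass.choose,
      (chain Γ hΓ n).2.exists_galoisStructure_extClass.choose_spec.2⟩

lemma chain_zero_X (Γ : GaloisStructure E) (hΓ : Γ.Conditions) :
    (chain Γ hΓ 0).1.X = Γ.coverings :=
  hΓ.exists_galoisStructure_extClass.choose_spec.1

lemma chain_succ_X (Γ : GaloisStructure E) (hΓ : Γ.Conditions) (n : ℕ) :
    (chain Γ hΓ (n + 1)).1.X = (chain Γ hΓ n).1.coverings :=
  (chain Γ hΓ n).2.exists_galoisStructure_extClass.choose_spec.1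

end GaloisStructure

end HigherGalois

theorem theorem3 {C : Type u} [CategoryTheory.Category.{v} C]
    {E : CategoryTheory.MorphismProperty C} (Γ : HigherGalois.GaloisStructure E) (hΓ : Γ.Conditions) :
    -- the induced Galois structure `Γ₁`
    (∃ Γ₁ : HigherGalois.GaloisStructure (HigherGalois.extClass E), Γ₁.X = Γ.coverings ∧ Γ₁.Conditions) ∧
    -- the chain of Galois structures; `Γs n` is `Γ_{n+1}`
    (∃ Γs : ∀ n : ℕ, HigherGalois.GaloisStructure (HigherGalois.iterExt E n).E,
      (Γs 0).X = Γ.coverings ∧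
      (∀ n : ℕ, (Γs (n + 1)).X = (Γs n).coverings) ∧
      (∀ n : ℕ, (Γs n).Conditions) ∧
      (∀ (n : ℕ) ⦃T B : (HigherGalois.iterExt E n).carrier⦄ (p : T ⟶ B),
        (HigherGalois.iterExt E n).E p → (Γs n).IsMonadicExtension p) ∧
      (∀ (n : ℕ) ⦃A B : (HigherGalois.iterExt E n).carrier⦄ (f : A ⟶ B),
        (Γs n).IsCovering f → (Γs n).IsNormalExtension f)) ∧
    -- the case `n = 0` of the last claim
    (∀ ⦃A B : C⦄ (f : A ⟶ B), Γ.IsCovering f → Γ.IsNormalExtension f) := by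
  refine ⟨hΓ.exists_galoisStructure_extClass, ⟨fun n => (Γ.chain hΓ n).1, Γ.chain_zero_X hΓ,
    Γ.chain_succ_X hΓ, fun n => (Γ.chain hΓ n).2, fun n T B p hp => (Γ.chain hΓ n).2.m p hp,
    fun n A B f hf => (Γ.chain hΓ n).2.isNormalExtension_of_isCovering hf⟩,
    fun A B f hf => hΓ.isNormalExtension_of_isCovering hf⟩
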